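/- Let $s_1,s_2>0$, let $\mathcal D\subseteq\mathbb R^k$ be the set of possible values of the controllable variables, and let $\mathbf D=(\mathbf d_1,\dots,\mathbf d_n)\in\mathcal D^n$ denote a design. Let $\Theta\subseteq\mathbb R^p$ be open, let $\mu(\boldsymbol\theta,\mathbf d)$ be a real mean function which, for each $\mathbf d\in\mathcal D$, is differentiable in $\boldsymbol\theta\in\Theta$, and let $\boldsymbol\theta$ have a prior probability distribution on $\mathbb R^p$ that gives $\Theta$ probability one. Given $\boldsymbol\theta$ and $\gamma$, the responses $y_1,\dots,y_n$ are independent with $y_i\sim \mathrm N(\mu(\boldsymbol\theta,\mathbf d_i),\gamma)$, where the unknown variance $\gamma$ has, independently of $\boldsymbol\theta$, the inverse-gamma prior $\mathrm{IG}(s_1/2,s_2/2)$, with density $\pi(\gamma)\propto\gamma^{-s_1/2-1}e^{-s_2/(2\gamma)}$ on $(0,\infty)$. Let $$\pi(\mathbf y\mid\boldsymbol\theta,\mathbf D)=\int_0^\infty \pi(\mathbf y\mid\boldsymbol\theta,\gamma,\mathbf D)\,\pi(\gamma)\,\mathrm d\gamma$$ be the marginal likelihood, let $$\mathcal I(\boldsymbol\theta;\mathbf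 D)=\mathrm E_{\mathbf y\mid\boldsymbol\theta,\mathbf D}\!\left[\frac{\partial\log\pi(\mathbf y\mid\boldsymbol\theta,\mathbf D)}{\partial\boldsymbol\theta}\,\frac{\partial\log\pi(\mathbf y\mid\boldsymbol\theta,\mathbf D)}{\partial\boldsymbol\theta^{\mathrm T}}\right]$$ be its Fisher information matrix, let $M$ be the $n\times p$ matrix with entries $M_{ij}=\partial\mu(\boldsymbol\theta,\mathbf d_i)/\partial\theta_j$, and put $$\phi(\mathbf d)=\sum_{j=1}^p\mathrm E_{\boldsymbol\theta}\!\left[\left(\frac{\partial\mu(\boldsymbol\theta,\mathbf d)}{\partial\theta_j}\right)^2\right],\qquad c=\frac{s_1(s_1+n)}{s_2(s_1+n+2)},$$ where the expectations that define $\phi(\mathbf d)$ are assumed finite for every $\mathbf d\in\mathcal D$. Then: 1. The marginal likelihood is the density of the $n$-variate t-distribution with location vector $(\mu(\boldsymbol\theta,\mathbf d_1),\dots,\mu(\boldsymbol\theta,\mathbf d_n))^{\mathrm T}$, scale matrix $(s_2/s_1)I_n$ and $s_1$ degrees of freedom. 2. For every $\boldsymbol\theta\in\Theta$ the expectations in $\mathcal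 I(\boldsymbol\theta;\mathbf D)$ exist, and $\mathcal I(\boldsymbol\theta;\mathbf D)=c\,M^{\mathrm T}M$. 3. $\mathrm E_{\boldsymbol\theta}[\mathrm{tr}\,\mathcal I(\boldsymbol\theta;\mathbf D)]$ is finite and equals $c\sum_{i=1}^n\phi(\mathbf d_i)$ for every $\mathbf D\in\mathcal D^n$. Consequently, a design maximises this objective over $\mathcal D^n$ if and only if each of its points $\mathbf d_i$ maximises $\phi$ over $\mathcal D$. 4. Suppose that the prior of $\boldsymbol\theta$ has a density $\pi(\boldsymbol\theta)$ that is differentiable at every point of $\Theta$. Let $$u_{FIG}(\boldsymbol\theta,\mathbf y,\mathbf D)=\left\Vert\frac{\partial\log\pi(\boldsymbol\theta\mid\mathbf y,\mathbf D)}{\partial\boldsymbol\theta}\right\Vert^2-\left\Vert\frac{\partial\log\pi(\boldsymbol\theta)}{\partial\boldsymbol\theta}\right\Vert^2$$ be the Fisher information gain utility (Euclidean norms), with the posterior density $\pi(\boldsymbol\theta\mid\mathbf y,\mathbf D)\propto\pi(\mathbf y\mid\boldsymbol\theta,\mathbf D)\pi(\boldsymbol\theta)$. If $u_{FIG}(\cdot,\cdot,\mathbf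 D)$ is integrable with respect to the joint distribution of $\boldsymbol\theta$ and $\mathbf y$, then $$U_{FIG}(\mathbf D)=\mathrm E_{\mathbf y,\boldsymbol\theta\mid\mathbf D}[u_{FIG}(\boldsymbol\theta,\mathbf y,\mathbf D)]=c\sum_{i=1}^n\phi(\mathbf d_i).$$ If this integrability holds for all $\mathbf D\in\mathcal D^n$, then a design maximises $U_{FIG}$ over $\mathcal D^n$ if and only if each of its points maximises $\phi$ over $\mathcal D$. The integrability holds for every $\mathbf D\in\mathcal D^n$ whenever $\mathrm E_{\boldsymbol\theta}[(\partial\log\pi(\boldsymbol\theta)/\partial\theta_j)^2]<\infty$ for $j=1,\dots,p$. -/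

import Mathlib

open MeasureTheory ProbabilityTheory

noncomputable section

namespace FIG

/-- The partial derivative `∂f/∂θ_j` at `θ`. -/
def pderiv {p : ℕ} (f : (Fin p → ℝ) → ℝ) (j : Fin p) (θ : Fin p → ℝ) : ℝ :=
  lineDeriv ℝ f θ (Pi.single j 1)

/-- The density of the inverse-gamma distribution with shape `α` and scale `β`. -/
def invGammaPDF (α β γ : ℝ) : ℝ :=
  if 0 < γ then β ^ α / Real.Gamma α * γ ^ (-α - 1) * Real.exp (-β / γ) else 0

/-- The density of the multivariate t-distribution with `ν` degrees of freedom, location vector `m`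
and scale matrix `S`. -/
def multivariateTPDF {n : ℕ} (ν : ℝ) (m : Fin n → ℝ) (S : Matrix (Fin n) (Fin n) ℝ)
    (y : Fin n → ℝ) : ℝ :=
  Real.Gamma ((ν + n) / 2) /
      (Real.Gamma (ν / 2) * (ν * Real.pi) ^ ((n : ℝ) / 2) * S.det ^ ((1 : ℝ) / 2)) *
    (1 + (y - m) ⬝ᵥ S⁻¹.mulVec (y - m) / ν) ^ (-(ν + n) / 2)

section Model

variable {p n k : ℕ} (s₁ s₂ : ℝ) (μ : (Fin p → ℝ) → (Fin k → ℝ) → ℝ)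

/-- The conditional likelihood `π(y | θ, γ, D)`: given the parameters, the responses are independent
and `y_i` is normal with mean `μ(θ, d_i)` and variance `γ`. -/
def condLik (D : Fin n → Fin k → ℝ) (θ : Fin p → ℝ) (γ : ℝ) (y : Fin n → ℝ) : ℝ :=
  ∏ i, gaussianPDFReal (μ θ (D i)) γ.toNNReal (y i)

/-- The marginal likelihood `π(y | θ, D) = ∫ π(y | θ, γ, D) π(γ) dγ`, where `γ` has the
`IG(s₁/2, s₂/2)` prior. -/
def margLik (D : Fin n → Fin k → ℝ) (θ : Fin p → ℝ) (y : Fin n → ℝ) : ℝ :=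
  ∫ γ in Set.Ioi (0 : ℝ), condLik μ D θ γ y * invGammaPDF (s₁ / 2) (s₂ / 2) γ

/-- The distribution of the responses given `θ` and the design, `γ` being integrated out. -/
def responseLaw (D : Fin n → Fin k → ℝ) (θ : Fin p → ℝ) : Measure (Fin n → ℝ) :=
  volume.withDensity fun y => ENNReal.ofReal (margLik s₁ s₂ μ D θ y)

/-- The score `∂ log π(y | θ, D) / ∂θ_j`. -/
def score (D : Fin n → Fin k → ℝ) (θ : Fin p → ℝ) (y : Fin n → ℝ) (j : Fin p) : ℝ :=
  pderiv (fun θ' => Real.log (margLik s₁ s₂ μ D θ' y)) j θ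

/-- The Fisher information matrix of the marginal likelihood. -/
def fisherInfo (D : Fin n → Fin k → ℝ) (θ : Fin p → ℝ) : Matrix (Fin p) (Fin p) ℝ :=
  Matrix.of fun j l =>
    ∫ y, score s₁ s₂ μ D θ y j * score s₁ s₂ μ D θ y l ∂(responseLaw s₁ s₂ μ D θ)

/-- The `n × p` matrix of partial derivatives of the mean responses. -/
def jacobian (D : Fin n → Fin k → ℝ) (θ : Fin p → ℝ) : Matrix (Fin n) (Fin p) ℝ :=
  Matrix.of fun i j => pderiv (fun θ' => μ θ' (D i)) j θ

/-- The prior expectation of the trace of the Fisher information matrix. -/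
def expectedTrace (P : Measure (Fin p → ℝ)) (D : Fin n → Fin k → ℝ) : ℝ :=
  ∫ θ, (fisherInfo s₁ s₂ μ D θ).trace ∂P

/-- `φ(d) = ∑ j, E_θ[(∂μ(θ, d)/∂θ_j)²]`. -/
def phi (P : Measure (Fin p → ℝ)) (d : Fin k → ℝ) : ℝ :=
  ∑ j, ∫ θ, pderiv (fun θ' => μ θ' d) j θ ^ 2 ∂P

/-- The posterior density `π(θ | y, D)` by Bayes' theorem, `prior` being the prior density. -/
def posterior (prior : (Fin p → ℝ) → ℝ) (D : Fin n → Fin k → ℝ) (y : Fin n → ℝ)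
    (θ : Fin p → ℝ) : ℝ :=
  margLik s₁ s₂ μ D θ y * prior θ / ∫ θ', margLik s₁ s₂ μ D θ' y * prior θ'

/-- The Fisher information gain utility: squared Euclidean length of the gradient of the log
posterior density minus that of the gradient of the log prior density. -/
def utilityFIG (prior : (Fin p → ℝ) → ℝ) (θ : Fin p → ℝ) (y : Fin n → ℝ)
    (D : Fin n → Fin k → ℝ) : ℝ :=
  ∑ j, pderiv (fun θ' => Real.log (posterior s₁ s₂ μ prior D y θ')) j θ ^ 2 -
    ∑ j, pderiv (fun θ' => Real.log (prior θ')) j θ ^ 2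

/-- The joint distribution of `(θ, y)` under the design `D`. -/
def jointLaw (prior : (Fin p → ℝ) → ℝ) (D : Fin n → Fin k → ℝ) :
    Measure ((Fin p → ℝ) × (Fin n → ℝ)) :=
  volume.withDensity fun z => ENNReal.ofReal (margLik s₁ s₂ μ D z.1 z.2 * prior z.1)

/-- The expected Fisher information gain utility of the design `D`. -/
def expectedFIG (prior : (Fin p → ℝ) → ℝ) (D : Fin n → Fin k → ℝ) : ℝ :=
  ∫ z, utilityFIG s₁ s₂ μ prior z.1 z.2 D ∂(jointLaw s₁ s₂ μ prior D)

end Model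

/-- `D` maximises the objective `U` over the design space `𝒟ⁿ`. -/
def IsOptimalDesign {n k : ℕ} (𝒟 : Set (Fin k → ℝ)) (U : (Fin n → Fin k → ℝ) → ℝ)
    (D : Fin n → Fin k → ℝ) : Prop :=
  (∀ i, D i ∈ 𝒟) ∧ ∀ D' : Fin n → Fin k → ℝ, (∀ i, D' i ∈ 𝒟) → U D' ≤ U D

end FIG

end

/-! Conjugacy makes everything explicit. As a function of γ, the Gaussian likelihood times the
inverse-gamma density is an unnormalised inverse-gamma density. Integrating γ out leaves a constant
times `(1 + |r|²/s₂)^(-(s₁+n)/2)` in the residuals `r = y - μ`, which is `centredTPDF`.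
Differentiating its logarithm gives the score `(s₁+n) (s₂+|r|²)⁻¹ ⟨r, a⟩` (`directionalScore`),
where `a` is a column of the Jacobian.

A product of two scores carries the factor `(s₂+|r|²)⁻²`, and this factor turns the t density into a
multiple of the t density with `s₁+4` degrees of freedom (`inv_sq_mul_centredTPDF`). Only second
moments of the latter are needed. They exist for every `s₁ > 0`, equal `s₂/(s₁+2)` on the diagonal
and vanish off it by a sign change of one coordinate. The constants multiply to `c`
(`integral_directionalScore_mul`). The expected trace is therefore a positive multiple of a sum with
one term per design point, and such a sum is maximised term by term (`isOptimalDesign_iff`).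

For the utility, the posterior normaliser does not depend on θ, so the gradient of the log posterior
is the score `S` plus the gradient of the log prior, and the utility is `|S|² + 2 ⟨S, ∇ log prior⟩`.
Given θ, the score is odd in the residuals and their density is even, so the cross term has mean
zero (`integral_sum_scoreFormula_mul`). The mean of `|S|²` is the expected trace. -/

noncomputable section

namespace FIG

/-! ### Integrating out the variance: closed form of the marginal likelihood -/

/-- The substitution `γ ↦ γ⁻¹` turns the inverse-gamma integral into Euler's integral. -/
theorem integral_rpow_mul_exp_neg_div {a b : ℝ} (ha : 0 < a) (hb : 0 < b) :
    ∫ γ in Set.Ioi (0 : ℝ), γ ^ (-a - 1) * Real.exp (-b / γ) = Real.Gamma a * b ^ (-a) := by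
  have h := integral_comp_rpow_Ioi (fun x : ℝ => x ^ (a - 1) * Real.exp (-(b * x)))
    (p := -1) (by norm_num)
  rw [Real.integral_rpow_mul_exp_neg_mul_Ioi ha hb] at h
  rw [mul_comm, Real.rpow_neg hb.le, ← Real.inv_rpow hb.le, ← one_div, ← h]
  refine setIntegral_congr_fun measurableSet_Ioi fun x (hx : 0 < x) => ?_
  simp only [abs_neg, abs_one, one_mul, smul_eq_mul, Real.rpow_neg_one]
  rw [← mul_assoc, Real.inv_rpow hx.le, ← Real.rpow_neg hx.le, ← Real.rpow_add hx]
  congr 2 <;> ring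

/-- A Bochner integral that is not zero certifies integrability, because the integral of a
non-integrable function is zero by convention. The Gaussian products below use the same device. -/
theorem integrableOn_rpow_mul_exp_neg_div {a b : ℝ} (ha : 0 < a) (hb : 0 < b) :
    IntegrableOn (fun γ : ℝ => γ ^ (-a - 1) * Real.exp (-b / γ)) (Set.Ioi 0) := by
  refine not_imp_comm.1 integral_undef ?_
  rw [integral_rpow_mul_exp_neg_div ha hb]
  exact (mul_pos (Real.Gamma_pos_of_pos ha) (Real.rpow_pos_of_pos hb _)).ne'

/-- The density of the `n`-variate t-distribution with `s₁` degrees of freedom, location zero and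
scale matrix `(s₂ / s₁) • 1`. -/
def centredTPDF {n : ℕ} (s₁ s₂ : ℝ) (r : Fin n → ℝ) : ℝ :=
  Real.Gamma ((s₁ + n) / 2) / (Real.Gamma (s₁ / 2) * (s₂ * Real.pi) ^ ((n : ℝ) / 2)) *
    (1 + (∑ i, r i ^ 2) / s₂) ^ (-((s₁ + n) / 2))

section
variable {n : ℕ} {s₁ s₂ : ℝ}

theorem one_add_sum_sq_div_pos (hs₂ : 0 < s₂) (r : Fin n → ℝ) : 0 < 1 + (∑ i, r i ^ 2) / s₂ := by
  positivity

theorem centredTPDF_pos (hs₁ : 0 < s₁) (hs₂ : 0 < s₂) (r : Fin n → ℝ) :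
    0 < centredTPDF s₁ s₂ r := by
  have h₁ := Real.Gamma_pos_of_pos (s := (s₁ + n) / 2) (by positivity)
  have h₂ := Real.Gamma_pos_of_pos (s := s₁ / 2) (by positivity)
  have h₃ := Real.rpow_pos_of_pos (one_add_sum_sq_div_pos hs₂ r) (-((s₁ + n) / 2))
  unfold centredTPDF
  positivity

theorem measurable_centredTPDF : Measurable (centredTPDF s₁ s₂ : (Fin n → ℝ) → ℝ) := by
  unfold centredTPDF
  fun_prop

theorem prod_gaussianPDFReal (m y : Fin n → ℝ) {γ : ℝ} (hγ : 0 < γ) :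
    ∏ i, gaussianPDFReal (m i) γ.toNNReal (y i) =
      (2 * Real.pi * γ) ^ (-(n : ℝ) / 2) * Real.exp (-((∑ i, (y i - m i) ^ 2) / 2) / γ) := by
  simp only [gaussianPDFReal, Real.coe_toNNReal _ hγ.le]
  rw [Finset.prod_mul_distrib, Finset.prod_const, Finset.card_univ, Fintype.card_fin,
    ← Real.exp_sum]
  congr 1
  · rw [Real.sqrt_eq_rpow, ← Real.rpow_neg (by positivity), ← Real.rpow_natCast,
      ← Real.rpow_mul (by positivity)]
    congr 1
    ring
  · rw [← Finset.sum_div, Finset.sum_neg_distrib]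
    congr 1
    field_simp

/-- Conjugacy: the shape `s₁/2` is updated to `(s₁+n)/2`, and half the residual sum of squares is
added to the scale. -/
theorem prod_gaussianPDFReal_mul_invGammaPDF (m y : Fin n → ℝ) {γ : ℝ}
    (hγ : 0 < γ) :
    (∏ i, gaussianPDFReal (m i) γ.toNNReal (y i)) * invGammaPDF (s₁ / 2) (s₂ / 2) γ =
      (2 * Real.pi) ^ (-(n : ℝ) / 2) * ((s₂ / 2) ^ (s₁ / 2) / Real.Gamma (s₁ / 2)) *
        (γ ^ (-((s₁ + n) / 2) - 1) * Real.exp (-((s₂ + ∑ i, (y i - m i) ^ 2) / 2) / γ)) := by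
  rw [prod_gaussianPDFReal m y hγ, invGammaPDF, if_pos hγ,
    Real.mul_rpow (by positivity) hγ.le]
  have h₁ : γ ^ (-((s₁ + n) / 2) - 1) = γ ^ (-(n : ℝ) / 2) * γ ^ (-(s₁ / 2) - 1) := by
    rw [← Real.rpow_add hγ]; congr 1; ring
  have h₂ : Real.exp (-((s₂ + ∑ i, (y i - m i) ^ 2) / 2) / γ) =
      Real.exp (-((∑ i, (y i - m i) ^ 2) / 2) / γ) * Real.exp (-(s₂ / 2) / γ) := by
    rw [← Real.exp_add]; congr 1; ring
  rw [h₁, h₂]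
  ring

theorem integrableOn_prod_gaussianPDFReal_mul_invGammaPDF (hs₁ : 0 < s₁) (hs₂ : 0 < s₂)
    (m y : Fin n → ℝ) :
    IntegrableOn (fun γ : ℝ => (∏ i, gaussianPDFReal (m i) γ.toNNReal (y i)) *
      invGammaPDF (s₁ / 2) (s₂ / 2) γ) (Set.Ioi 0) := by
  refine IntegrableOn.congr_fun
    ((integrableOn_rpow_mul_exp_neg_div (by positivity) (by positivity)).const_mul _)
    (fun γ hγ => (prod_gaussianPDFReal_mul_invGammaPDF m y hγ).symm) measurableSet_Ioi

theorem integral_prod_gaussianPDFReal_mul_invGammaPDF (hs₁ : 0 < s₁) (hs₂ : 0 < s₂)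
    (m y : Fin n → ℝ) :
    ∫ γ in Set.Ioi (0 : ℝ), (∏ i, gaussianPDFReal (m i) γ.toNNReal (y i)) *
      invGammaPDF (s₁ / 2) (s₂ / 2) γ = centredTPDF s₁ s₂ (y - m) := by
  rw [setIntegral_congr_fun measurableSet_Ioi
    (fun γ hγ => prod_gaussianPDFReal_mul_invGammaPDF m y hγ), integral_const_mul,
    integral_rpow_mul_exp_neg_div (by positivity) (by positivity), centredTPDF]
  have h₁ : (s₂ + ∑ i, (y i - m i) ^ 2) / 2 =
      (s₂ / 2) * (1 + (∑ i, (y - m) i ^ 2) / s₂) := by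
    simp only [Pi.sub_apply]; field_simp
  have h₂ : (s₂ / 2) ^ (-((s₁ + n) / 2)) = (s₂ / 2) ^ (-(s₁ / 2)) * (s₂ / 2) ^ (-(n : ℝ) / 2) := by
    rw [← Real.rpow_add (by positivity)]; congr 1; ring
  have h₃ : (s₂ * Real.pi) ^ ((n : ℝ) / 2) =
      ((2 * Real.pi) ^ (-(n : ℝ) / 2) * (s₂ / 2) ^ (-(n : ℝ) / 2))⁻¹ := by
    rw [← Real.mul_rpow (by positivity) (by positivity), neg_div,
      Real.rpow_neg (by positivity), inv_inv]
    congr 1; ring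
  have h₄ : (s₂ / 2) ^ (s₁ / 2) * (s₂ / 2) ^ (-(s₁ / 2)) = 1 := by
    rw [← Real.rpow_add (by positivity)]; simp
  rw [h₁, Real.mul_rpow (by positivity) (one_add_sum_sq_div_pos hs₂ _).le, h₂, h₃,
    div_mul_eq_div_div, div_inv_eq_mul]
  -- The two sides now differ only by `(s₂/2)^(s₁/2) * (s₂/2)^(-(s₁/2))`, which `h₄` cancels.
  linear_combination ((2 * Real.pi) ^ (-(n : ℝ) / 2) / Real.Gamma (s₁ / 2) *
    Real.Gamma ((s₁ + n) / 2) * (s₂ / 2) ^ (-(n : ℝ) / 2) *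
    (1 + (∑ i, (y - m) i ^ 2) / s₂) ^ (-((s₁ + n) / 2))) * h₄

theorem multivariateTPDF_smul_one (hs₁ : 0 < s₁) (hs₂ : 0 < s₂) (m y : Fin n → ℝ) :
    multivariateTPDF s₁ m ((s₂ / s₁) • (1 : Matrix (Fin n) (Fin n) ℝ)) y =
      centredTPDF s₁ s₂ (y - m) := by
  have hc : s₂ / s₁ ≠ 0 := by positivity
  have hinv : ((s₂ / s₁) • (1 : Matrix (Fin n) (Fin n) ℝ))⁻¹ = (s₁ / s₂) • 1 := by
    refine Matrix.inv_eq_right_inv ?_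
    rw [smul_mul_smul_comm, one_mul, div_mul_div_cancel₀ hs₁.ne', div_self hs₂.ne', one_smul]
  rw [multivariateTPDF, centredTPDF, hinv, Matrix.smul_mulVec, Matrix.one_mulVec,
    dotProduct_smul, Matrix.det_smul, Matrix.det_one, mul_one, Fintype.card_fin]
  have h₁ : (y - m) ⬝ᵥ (y - m) = ∑ i, (y - m) i ^ 2 := by
    simp only [dotProduct, sq]
  have h₂ : ((s₂ / s₁) ^ n) ^ ((1 : ℝ) / 2) = (s₂ / s₁) ^ ((n : ℝ) / 2) := by
    rw [← Real.rpow_natCast, ← Real.rpow_mul (by positivity)]; congr 1; ring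
  have h₃ : s₁ * Real.pi * (s₂ / s₁) = s₂ * Real.pi := by field_simp
  rw [h₁, h₂, mul_assoc (Real.Gamma _), ← Real.mul_rpow (by positivity) (by positivity), h₃]
  congr 2
  · rw [smul_eq_mul]; field_simp
  · ring

/-- This uniform bound makes the likelihood integrable in θ against the prior, as needed for the
posterior normaliser. -/
theorem centredTPDF_le (hs₁ : 0 < s₁) (hs₂ : 0 < s₂) (r : Fin n → ℝ) :
    centredTPDF s₁ s₂ r ≤ centredTPDF s₁ s₂ (0 : Fin n → ℝ) := by
  have h₁ := Real.Gamma_pos_of_pos (s := (s₁ + n) / 2) (by positivity)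
  have h₂ := Real.Gamma_pos_of_pos (s := s₁ / 2) (by positivity)
  unfold centredTPDF
  refine mul_le_mul_of_nonneg_left ?_ (by positivity)
  refine Real.rpow_le_rpow_of_nonpos (by simp) ?_ (by linarith [show 0 < (s₁ + n) / 2 by positivity])
  simp only [Pi.zero_apply]
  norm_num
  positivity

end

/-! ### Mass and second moments of the t-distribution as a normal mixture -/

theorem invGammaPDF_nonneg {α β : ℝ} (hα : 0 < α) (hβ : 0 < β) (γ : ℝ) :
    0 ≤ invGammaPDF α β γ := by
  have := Real.Gamma_pos_of_pos hα
  unfold invGammaPDF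
  split_ifs <;> positivity

theorem measurable_invGammaPDF {α β : ℝ} : Measurable (invGammaPDF α β) := by
  unfold invGammaPDF
  exact Measurable.ite measurableSet_Ioi (by fun_prop) measurable_const

theorem lintegral_invGammaPDF {α β : ℝ} (hα : 0 < α) (hβ : 0 < β) :
    ∫⁻ γ in Set.Ioi (0 : ℝ), ENNReal.ofReal (invGammaPDF α β γ) = 1 := by
  have hΓ := Real.Gamma_pos_of_pos hα
  have hf : Set.EqOn (fun γ : ℝ => β ^ α / Real.Gamma α * (γ ^ (-α - 1) * Real.exp (-β / γ)))
      (invGammaPDF α β) (Set.Ioi 0) := fun γ (hγ : 0 < γ) => by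
    simp only [invGammaPDF, if_pos hγ, mul_assoc]
  have hint : IntegrableOn (invGammaPDF α β) (Set.Ioi 0) :=
    IntegrableOn.congr_fun ((integrableOn_rpow_mul_exp_neg_div hα hβ).const_mul _) hf
      measurableSet_Ioi
  rw [← ofReal_integral_eq_lintegral_ofReal hint
    (Filter.Eventually.of_forall (invGammaPDF_nonneg hα hβ)),
    ← setIntegral_congr_fun measurableSet_Ioi hf, integral_const_mul,
    integral_rpow_mul_exp_neg_div hα hβ, ← ENNReal.ofReal_one, Real.rpow_neg hβ.le]
  congr 1
  have := Real.rpow_pos_of_pos hβ α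
  field_simp

/-- A factor γ lowers the shape by one, and `Γ(α) = (α-1) Γ(α-1)` supplies the constant; this yields
the inverse-gamma mean. -/
theorem mul_invGammaPDF {α β γ : ℝ} (hα : 1 < α) (hβ : 0 < β) (hγ : 0 < γ) :
    γ * invGammaPDF α β γ = β / (α - 1) * invGammaPDF (α - 1) β γ := by
  have hΓ := Real.Gamma_pos_of_pos (sub_pos.2 hα)
  have hα' : α - 1 ≠ 0 := (sub_pos.2 hα).ne'
  simp only [invGammaPDF, if_pos hγ]
  have h₁ : Real.Gamma α = (α - 1) * Real.Gamma (α - 1) := by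
    rw [← Real.Gamma_add_one hα', sub_add_cancel]
  have h₂ : γ ^ (-(α - 1) - 1) = γ * γ ^ (-α - 1) := by
    rw [← Real.rpow_one_add' hγ.le (by linarith)]; congr 1; ring
  have h₃ : β ^ α = β * β ^ (α - 1) := by
    rw [← Real.rpow_one_add' hβ.le (by linarith)]; congr 1; ring
  rw [h₁, h₂, h₃]
  field_simp

theorem lintegral_mul_invGammaPDF {α β : ℝ} (hα : 1 < α) (hβ : 0 < β) :
    ∫⁻ γ in Set.Ioi (0 : ℝ), ENNReal.ofReal γ * ENNReal.ofReal (invGammaPDF α β γ) =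
      ENNReal.ofReal (β / (α - 1)) := by
  have hα' : 0 < α - 1 := sub_pos.2 hα
  rw [setLIntegral_congr_fun (g := fun γ => ENNReal.ofReal (β / (α - 1)) *
    ENNReal.ofReal (invGammaPDF (α - 1) β γ)) measurableSet_Ioi fun γ (hγ : 0 < γ) => ?_,
    lintegral_const_mul _ measurable_invGammaPDF.ennreal_ofReal,
    lintegral_invGammaPDF hα' hβ, mul_one]
  simp only
  rw [← ENNReal.ofReal_mul hγ.le, mul_invGammaPDF hα hβ hγ, ENNReal.ofReal_mul (by positivity)]

theorem integral_gaussianPDFReal_mul_sq {v : NNReal} (hv : v ≠ 0) :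
    ∫ x, gaussianPDFReal 0 v x * x ^ 2 = v := by
  have h := variance_eq_integral (μ := gaussianReal 0 v) (X := id) aemeasurable_id
  rw [variance_id_gaussianReal] at h
  simp only [id, integral_id_gaussianReal, sub_zero] at h
  rw [h, integral_gaussianReal_eq_integral_smul hv]
  rfl

/-- Tonelli for a mixture. Working in `ENNReal` gives the moments before any integrability is known.
-/
theorem lintegral_mul_lintegral_mul {α β : Type*} [MeasurableSpace α] [MeasurableSpace β]
    {ρ : Measure α} {ν : Measure β} [SFinite ρ] [SFinite ν] {h : α → ENNReal}
    {K : α × β → ENNReal} {w : β → ENNReal} (hh : Measurable h) (hK : Measurable K)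
    (hw : Measurable w) :
    ∫⁻ r, h r * ∫⁻ γ, K (r, γ) * w γ ∂ν ∂ρ = ∫⁻ γ, (∫⁻ r, h r * K (r, γ) ∂ρ) * w γ ∂ν := by
  have hF : Measurable fun z : α × β => h z.1 * (K z * w z.2) := by fun_prop
  calc
    _ = ∫⁻ r, ∫⁻ γ, h r * (K (r, γ) * w γ) ∂ν ∂ρ := by
      refine lintegral_congr fun r => ?_
      rw [lintegral_const_mul _ (by fun_prop)]
    _ = ∫⁻ γ, ∫⁻ r, h r * (K (r, γ) * w γ) ∂ρ ∂ν := lintegral_lintegral_swap hF.aemeasurable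
    _ = _ := by
      refine lintegral_congr fun γ => ?_
      rw [← lintegral_mul_const _ (by fun_prop)]
      simp only [mul_assoc]

section
variable {n : ℕ} {s₁ s₂ : ℝ}

theorem measurable_prod_gaussianPDFReal :
    Measurable fun z : (Fin n → ℝ) × ℝ =>
      ENNReal.ofReal (∏ i, gaussianPDFReal 0 z.2.toNNReal (z.1 i)) := by
  simp only [gaussianPDFReal]
  fun_prop

theorem lintegral_prod_gaussianPDFReal {γ : ℝ} (hγ : 0 < γ) :
    ∫⁻ r : Fin n → ℝ, ENNReal.ofReal (∏ i, gaussianPDFReal 0 γ.toNNReal (r i)) = 1 := by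
  have hv : γ.toNNReal ≠ 0 := by simpa using hγ
  have h : ∫ r : Fin n → ℝ, ∏ i, gaussianPDFReal 0 γ.toNNReal (r i) = 1 := by
    rw [integral_fintype_prod_volume_eq_prod (fun _ : Fin n => gaussianPDFReal 0 γ.toNNReal)]
    simp [integral_gaussianPDFReal_eq_one 0 hv]
  rw [← ofReal_integral_eq_lintegral_ofReal (not_imp_comm.1 integral_undef (h ▸ one_ne_zero))
    (Filter.Eventually.of_forall fun r =>
      Finset.prod_nonneg fun i _ => gaussianPDFReal_nonneg _ _ _), h, ENNReal.ofReal_one]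

theorem lintegral_sq_mul_prod_gaussianPDFReal {γ : ℝ} (hγ : 0 < γ) (k : Fin n) :
    ∫⁻ r : Fin n → ℝ, ENNReal.ofReal (r k ^ 2) *
      ENNReal.ofReal (∏ i, gaussianPDFReal 0 γ.toNNReal (r i)) = ENNReal.ofReal γ := by
  have hv : γ.toNNReal ≠ 0 := by simpa using hγ
  -- The square is absorbed into the `k`-th factor, so the integral still factorises and every other
  -- factor integrates to one.
  have hprod : ∀ r : Fin n → ℝ, r k ^ 2 * ∏ i, gaussianPDFReal 0 γ.toNNReal (r i) =
      ∏ i, gaussianPDFReal 0 γ.toNNReal (r i) * (if i = k then r i ^ 2 else 1) := fun r => by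
    rw [Finset.prod_mul_distrib, Finset.prod_ite_eq' Finset.univ k fun i => r i ^ 2,
      if_pos (Finset.mem_univ _), mul_comm]
  have h : ∫ r : Fin n → ℝ, r k ^ 2 * ∏ i, gaussianPDFReal 0 γ.toNNReal (r i) = γ := by
    simp only [hprod]
    rw [integral_fintype_prod_volume_eq_prod
      (fun (i : Fin n) x => gaussianPDFReal 0 γ.toNNReal x * (if i = k then x ^ 2 else 1)),
      Finset.prod_eq_single k]
    · simp [integral_gaussianPDFReal_mul_sq hv, hγ.le]
    · intro i _ hi
      simp [hi, integral_gaussianPDFReal_eq_one 0 hv]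
    · simp
  simp only [← ENNReal.ofReal_mul (sq_nonneg _)]
  rw [← ofReal_integral_eq_lintegral_ofReal (not_imp_comm.1 integral_undef (h.trans_ne hγ.ne'))
    (Filter.Eventually.of_forall fun r => mul_nonneg (sq_nonneg _)
      (Finset.prod_nonneg fun i _ => gaussianPDFReal_nonneg _ _ _)), h]

theorem ofReal_centredTPDF (hs₁ : 0 < s₁) (hs₂ : 0 < s₂) (r : Fin n → ℝ) :
    ENNReal.ofReal (centredTPDF s₁ s₂ r) =
      ∫⁻ γ in Set.Ioi (0 : ℝ), ENNReal.ofReal (∏ i, gaussianPDFReal 0 γ.toNNReal (r i)) *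
        ENNReal.ofReal (invGammaPDF (s₁ / 2) (s₂ / 2) γ) := by
  have hprod : ∀ γ : ℝ, 0 ≤ ∏ i, gaussianPDFReal 0 γ.toNNReal (r i) := fun γ =>
    Finset.prod_nonneg fun i _ => gaussianPDFReal_nonneg _ _ _
  have h := integral_prod_gaussianPDFReal_mul_invGammaPDF hs₁ hs₂ 0 r
  simp only [sub_zero, Pi.zero_apply] at h
  rw [← h, ofReal_integral_eq_lintegral_ofReal]
  · simp only [ENNReal.ofReal_mul (hprod _)]
  · exact integrableOn_prod_gaussianPDFReal_mul_invGammaPDF hs₁ hs₂ 0 r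
  · exact Filter.Eventually.of_forall fun γ => mul_nonneg (hprod γ)
      (invGammaPDF_nonneg (by positivity) (by positivity) _)

/-- The t-distribution is a mixture of normal distributions with inverse-gamma variance. -/
theorem lintegral_mul_centredTPDF (hs₁ : 0 < s₁) (hs₂ : 0 < s₂) {h : (Fin n → ℝ) → ENNReal}
    (hh : Measurable h) :
    ∫⁻ r, h r * ENNReal.ofReal (centredTPDF s₁ s₂ r) =
      ∫⁻ γ in Set.Ioi (0 : ℝ),
        (∫⁻ r, h r * ENNReal.ofReal (∏ i, gaussianPDFReal 0 γ.toNNReal (r i))) *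
          ENNReal.ofReal (invGammaPDF (s₁ / 2) (s₂ / 2) γ) := by
  simp only [ofReal_centredTPDF hs₁ hs₂]
  exact lintegral_mul_lintegral_mul hh measurable_prod_gaussianPDFReal
    measurable_invGammaPDF.ennreal_ofReal

theorem lintegral_centredTPDF (hs₁ : 0 < s₁) (hs₂ : 0 < s₂) :
    ∫⁻ r : Fin n → ℝ, ENNReal.ofReal (centredTPDF s₁ s₂ r) = 1 := by
  have h := lintegral_mul_centredTPDF (n := n) hs₁ hs₂ (h := fun _ => 1) measurable_const
  simp only [one_mul] at h
  rw [h, setLIntegral_congr_fun measurableSet_Ioi fun γ (hγ : 0 < γ) => by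
    rw [lintegral_prod_gaussianPDFReal hγ, one_mul],
    lintegral_invGammaPDF (by positivity) (by positivity)]

/-- By mixing, the second moment is the inverse-gamma mean of γ, finite once the shape `s₁/2`
exceeds one. The score computation applies this with `s₁ + 4` in place of `s₁`, where the threshold
is automatic. -/
theorem lintegral_sq_mul_centredTPDF (hs₁ : 2 < s₁) (hs₂ : 0 < s₂) (k : Fin n) :
    ∫⁻ r : Fin n → ℝ, ENNReal.ofReal (r k ^ 2) * ENNReal.ofReal (centredTPDF s₁ s₂ r) =
      ENNReal.ofReal (s₂ / (s₁ - 2)) := by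
  rw [lintegral_mul_centredTPDF (by positivity) hs₂ (by fun_prop),
    setLIntegral_congr_fun measurableSet_Ioi fun γ (hγ : 0 < γ) => by
      rw [lintegral_sq_mul_prod_gaussianPDFReal hγ k],
    lintegral_mul_invGammaPDF (by linarith) (by positivity)]
  congr 1
  have : s₁ - 2 ≠ 0 := by linarith
  have : s₁ / 2 - 1 ≠ 0 := by intro h; apply this; linarith
  field_simp

theorem integrable_centredTPDF (hs₁ : 0 < s₁) (hs₂ : 0 < s₂) :
    Integrable (centredTPDF s₁ s₂ : (Fin n → ℝ) → ℝ) := by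
  refine (lintegral_ofReal_ne_top_iff_integrable measurable_centredTPDF.aestronglyMeasurable
    (Filter.Eventually.of_forall fun r => (centredTPDF_pos hs₁ hs₂ r).le)).1 ?_
  simp [lintegral_centredTPDF hs₁ hs₂]

theorem ofReal_sq_mul_centredTPDF (r : Fin n → ℝ) (k : Fin n) :
    ENNReal.ofReal (r k ^ 2 * centredTPDF s₁ s₂ r) =
      ENNReal.ofReal (r k ^ 2) * ENNReal.ofReal (centredTPDF s₁ s₂ r) :=
  ENNReal.ofReal_mul (sq_nonneg _)

theorem integrable_sq_mul_centredTPDF (hs₁ : 2 < s₁) (hs₂ : 0 < s₂) (k : Fin n) :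
    Integrable fun r : Fin n → ℝ => r k ^ 2 * centredTPDF s₁ s₂ r := by
  refine (lintegral_ofReal_ne_top_iff_integrable
    ((by fun_prop : Measurable fun r : Fin n → ℝ => r k ^ 2).mul
      measurable_centredTPDF).aestronglyMeasurable
    (Filter.Eventually.of_forall fun r =>
      mul_nonneg (sq_nonneg _) (centredTPDF_pos (by linarith) hs₂ r).le)).1 ?_
  simp [ofReal_sq_mul_centredTPDF, lintegral_sq_mul_centredTPDF hs₁ hs₂]

theorem integral_sq_mul_centredTPDF (hs₁ : 2 < s₁) (hs₂ : 0 < s₂) (k : Fin n) :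
    ∫ r : Fin n → ℝ, r k ^ 2 * centredTPDF s₁ s₂ r = s₂ / (s₁ - 2) := by
  have := sub_pos.2 hs₁
  rw [integral_eq_lintegral_of_nonneg_ae (Filter.Eventually.of_forall fun r =>
      mul_nonneg (sq_nonneg _) (centredTPDF_pos (by linarith) hs₂ r).le)
    (integrable_sq_mul_centredTPDF hs₁ hs₂ k).1]
  simp only [ofReal_sq_mul_centredTPDF]
  rw [lintegral_sq_mul_centredTPDF hs₁ hs₂, ENNReal.toReal_ofReal (by positivity)]

/-- Damping by `(s₂ + |r|²)⁻²` raises the degrees of freedom by four. -/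
theorem inv_sq_mul_centredTPDF (hs₁ : 0 < s₁) (hs₂ : 0 < s₂) (r : Fin n → ℝ) :
    (s₂ + ∑ i, r i ^ 2)⁻¹ ^ 2 * centredTPDF s₁ s₂ r =
      s₁ * (s₁ + 2) / (s₂ ^ 2 * ((s₁ + n) * (s₁ + n + 2))) * centredTPDF (s₁ + 4) s₂ r := by
  have hb := one_add_sum_sq_div_pos hs₂ r
  -- Used at `a = s₁` and `a = s₁ + n`; the ratio of the two factors is the constant in the
  -- statement.
  have hG : ∀ a : ℝ, 0 < a → Real.Gamma ((a + 4) / 2) =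
      a * (a + 2) / 4 * Real.Gamma (a / 2) := fun a ha => by
    rw [show (a + 4) / 2 = a / 2 + 1 + 1 by ring, Real.Gamma_add_one (by positivity),
      Real.Gamma_add_one (by positivity)]
    ring
  have h₁ : s₂ + ∑ i, r i ^ 2 = s₂ * (1 + (∑ i, r i ^ 2) / s₂) := by field_simp
  have h₂ : (1 + (∑ i, r i ^ 2) / s₂) ^ (-((s₁ + 4 + n) / 2)) =
      (1 + (∑ i, r i ^ 2) / s₂)⁻¹ ^ 2 * (1 + (∑ i, r i ^ 2) / s₂) ^ (-((s₁ + n) / 2)) := by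
    rw [inv_pow, ← Real.rpow_natCast, ← Real.rpow_neg hb.le, ← Real.rpow_add hb]
    congr 1; push_cast; ring
  have hΓ := Real.Gamma_pos_of_pos (s := s₁ / 2) (by positivity)
  rw [centredTPDF, centredTPDF, h₂, h₁, hG s₁ hs₁,
    show s₁ + 4 + (n : ℝ) = s₁ + n + 4 by ring, hG (s₁ + n) (by positivity)]
  field_simp

end

/-! ### Symmetries and second moments of the score -/

theorem integral_eq_zero_of_odd {n : ℕ} {f : (Fin n → ℝ) → ℝ} (hf : ∀ r, f (-r) = -f r) :
    ∫ r, f r = 0 := by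
  have h := integral_neg_eq_self f volume
  simp only [hf, integral_neg] at h
  linarith

/-- The vector with the sign of its `i`-th coordinate changed. -/
def flipCoord {n : ℕ} (i : Fin n) (r : Fin n → ℝ) : Fin n → ℝ :=
  fun l => if l = i then -r l else r l

theorem measurePreserving_flipCoord {n : ℕ} (i : Fin n) :
    MeasurePreserving (flipCoord i) volume volume := by
  refine volume_preserving_pi (f := fun l x => if l = i then -x else x) fun l => ?_
  by_cases h : l = i
  · simpa only [if_pos h] using Measure.measurePreserving_neg (volume : Measure ℝ)
  · simpa only [if_neg h] using! MeasurePreserving.id (volume : Measure ℝ)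

theorem flipCoord_flipCoord {n : ℕ} (i : Fin n) (r : Fin n → ℝ) :
    flipCoord i (flipCoord i r) = r := by
  ext l
  by_cases h : l = i <;> simp [flipCoord, h]

theorem measurableEmbedding_flipCoord {n : ℕ} (i : Fin n) :
    MeasurableEmbedding (flipCoord i : (Fin n → ℝ) → _) :=
  MeasurableEquiv.measurableEmbedding
    ⟨⟨flipCoord i, flipCoord i, flipCoord_flipCoord i, flipCoord_flipCoord i⟩,
      (measurePreserving_flipCoord i).measurable, (measurePreserving_flipCoord i).measurable⟩

theorem sum_sq_flipCoord {n : ℕ} (i : Fin n) (r : Fin n → ℝ) :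
    ∑ l, flipCoord i r l ^ 2 = ∑ l, r l ^ 2 := by
  refine Finset.sum_congr rfl fun l _ => ?_
  by_cases h : l = i <;> simp [flipCoord, h]

section
variable {n : ℕ} {s₁ s₂ : ℝ}

/-- The directional derivative of the log density of the t-distribution, as a function of the
residuals `r`, when the location moves in the direction `a`. -/
def directionalScore (s₁ s₂ : ℝ) (a r : Fin n → ℝ) : ℝ :=
  (s₁ + n) * (s₂ + ∑ i, r i ^ 2)⁻¹ * ∑ i, r i * a i

theorem directionalScore_neg (a r : Fin n → ℝ) :
    directionalScore s₁ s₂ a (-r) = -directionalScore s₁ s₂ a r := by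
  simp [directionalScore]

theorem centredTPDF_neg (r : Fin n → ℝ) : centredTPDF s₁ s₂ (-r) = centredTPDF s₁ s₂ r := by
  simp [centredTPDF]

theorem measurable_directionalScore :
    Measurable fun z : (Fin n → ℝ) × (Fin n → ℝ) => directionalScore s₁ s₂ z.1 z.2 := by
  unfold directionalScore
  fun_prop

/-- Changing the sign of one coordinate preserves Lebesgue measure and the density but negates the
integrand. No integrability is needed. -/
theorem integral_mul_mul_centredTPDF_of_ne {i l : Fin n} (h : i ≠ l) :
    ∫ r : Fin n → ℝ, r i * r l * centredTPDF s₁ s₂ r = 0 := by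
  have h₁ := (measurePreserving_flipCoord i).integral_comp (measurableEmbedding_flipCoord i)
    fun r : Fin n → ℝ => r i * r l * centredTPDF s₁ s₂ r
  have h₂ : ∀ r : Fin n → ℝ, flipCoord i r i * flipCoord i r l *
      centredTPDF s₁ s₂ (flipCoord i r) = -(r i * r l * centredTPDF s₁ s₂ r) := fun r => by
    simp only [centredTPDF, sum_sq_flipCoord]
    simp [flipCoord, h.symm]
  simp only [h₂, integral_neg] at h₁
  linarith

theorem integrable_mul_mul_centredTPDF (hs₁ : 2 < s₁) (hs₂ : 0 < s₂) (i l : Fin n) :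
    Integrable fun r : Fin n → ℝ => r i * r l * centredTPDF s₁ s₂ r := by
  refine Integrable.mono' ((integrable_sq_mul_centredTPDF hs₁ hs₂ i).add
    (integrable_sq_mul_centredTPDF hs₁ hs₂ l))
    ((by fun_prop : Measurable fun r : Fin n → ℝ => r i * r l).mul
      measurable_centredTPDF).aestronglyMeasurable (Filter.Eventually.of_forall fun r => ?_)
  have hp := centredTPDF_pos (by linarith : 0 < s₁) hs₂ r
  rw [Real.norm_eq_abs, abs_mul, abs_of_pos hp, Pi.add_apply, ← add_mul]
  refine mul_le_mul_of_nonneg_right (abs_le.2 ⟨?_, ?_⟩) hp.le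
  · nlinarith [sq_nonneg (r i + r l), sq_nonneg (r i), sq_nonneg (r l)]
  · nlinarith [sq_nonneg (r i - r l), sq_nonneg (r i), sq_nonneg (r l)]

/-- The damping factor is traded for four degrees of freedom, so the score has second moments even
when the t-distribution itself has none. -/
theorem directionalScore_mul_directionalScore_mul_centredTPDF (hs₁ : 0 < s₁) (hs₂ : 0 < s₂)
    (a b r : Fin n → ℝ) :
    directionalScore s₁ s₂ a r * directionalScore s₁ s₂ b r * centredTPDF s₁ s₂ r =
      ∑ i, ∑ l, (s₁ + n) ^ 2 * (s₁ * (s₁ + 2) / (s₂ ^ 2 * ((s₁ + n) * (s₁ + n + 2)))) *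
        (a i * b l) * (r i * r l * centredTPDF (s₁ + 4) s₂ r) := by
  calc
    _ = (s₁ + n) ^ 2 * ((∑ i, r i * a i) * ∑ l, r l * b l) *
        ((s₂ + ∑ i, r i ^ 2)⁻¹ ^ 2 * centredTPDF s₁ s₂ r) := by
      unfold directionalScore; ring
    _ = _ := by
      rw [inv_sq_mul_centredTPDF hs₁ hs₂, Finset.sum_mul_sum, Finset.mul_sum, Finset.sum_mul]
      refine Finset.sum_congr rfl fun i _ => ?_
      rw [Finset.mul_sum, Finset.sum_mul]
      refine Finset.sum_congr rfl fun l _ => ?_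
      ring

theorem integrable_directionalScore_mul (hs₁ : 0 < s₁) (hs₂ : 0 < s₂) (a b : Fin n → ℝ) :
    Integrable fun r : Fin n → ℝ =>
      directionalScore s₁ s₂ a r * directionalScore s₁ s₂ b r * centredTPDF s₁ s₂ r := by
  simp only [directionalScore_mul_directionalScore_mul_centredTPDF hs₁ hs₂]
  exact integrable_finsetSum _ fun i _ => integrable_finsetSum _ fun l _ =>
    (integrable_mul_mul_centredTPDF (by linarith) hs₂ i l).const_mul _

/-- Only the diagonal terms survive, each with moment `s₂/(s₁+2)`; this cancels the `s₁+2` and one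
power of `s₂` in the constant. -/
theorem integral_directionalScore_mul (hs₁ : 0 < s₁) (hs₂ : 0 < s₂) (a b : Fin n → ℝ) :
    ∫ r : Fin n → ℝ,
      directionalScore s₁ s₂ a r * directionalScore s₁ s₂ b r * centredTPDF s₁ s₂ r =
      s₁ * (s₁ + n) / (s₂ * (s₁ + n + 2)) * ∑ i, a i * b i := by
  have hint := fun i l => integrable_mul_mul_centredTPDF (n := n) (s₁ := s₁ + 4)
    (by linarith) hs₂ i l
  simp only [directionalScore_mul_directionalScore_mul_centredTPDF hs₁ hs₂]
  rw [integral_finsetSum _ fun i _ => integrable_finsetSum _ fun l _ => (hint i l).const_mul _,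
    Finset.mul_sum]
  refine Finset.sum_congr rfl fun i _ => ?_
  rw [integral_finsetSum _ fun l _ => (hint i l).const_mul _, Finset.sum_eq_single i]
  · have h := integral_sq_mul_centredTPDF (s₁ := s₁ + 4) (by linarith) hs₂ i
    simp only [sq] at h
    rw [integral_const_mul, h, show s₁ + 4 - 2 = s₁ + 2 by ring]
    field_simp
  · intro l _ hl
    rw [integral_const_mul, integral_mul_mul_centredTPDF_of_ne hl.symm, mul_zero]
  · simp

end

/-! ### Score and Fisher information of the model -/

section Model
variable {p n k : ℕ} {s₁ s₂ : ℝ} {μ : (Fin p → ℝ) → (Fin k → ℝ) → ℝ}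

theorem margLik_eq (hs₁ : 0 < s₁) (hs₂ : 0 < s₂) (D : Fin n → Fin k → ℝ) (θ : Fin p → ℝ)
    (y : Fin n → ℝ) :
    margLik s₁ s₂ μ D θ y = centredTPDF s₁ s₂ (y - fun i => μ θ (D i)) :=
  integral_prod_gaussianPDFReal_mul_invGammaPDF hs₁ hs₂ _ y

theorem isProbabilityMeasure_responseLaw (hs₁ : 0 < s₁) (hs₂ : 0 < s₂) (D : Fin n → Fin k → ℝ)
    (θ : Fin p → ℝ) : IsProbabilityMeasure (responseLaw s₁ s₂ μ D θ) := by
  refine ⟨?_⟩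
  simp only [responseLaw, margLik_eq hs₁ hs₂]
  rw [withDensity_apply _ MeasurableSet.univ, Measure.restrict_univ,
    lintegral_sub_right_eq_self (fun r => ENNReal.ofReal (centredTPDF s₁ s₂ r)),
    lintegral_centredTPDF hs₁ hs₂]

theorem measurable_margLik (hs₁ : 0 < s₁) (hs₂ : 0 < s₂) (D : Fin n → Fin k → ℝ)
    (θ : Fin p → ℝ) : Measurable (margLik s₁ s₂ μ D θ) := by
  simp only [funext (margLik_eq hs₁ hs₂ D θ)]
  exact measurable_centredTPDF.comp (measurable_sub_const _)

theorem margLik_pos (hs₁ : 0 < s₁) (hs₂ : 0 < s₂) (D : Fin n → Fin k → ℝ)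
    (θ : Fin p → ℝ) (y : Fin n → ℝ) : 0 < margLik s₁ s₂ μ D θ y := by
  rw [margLik_eq hs₁ hs₂]
  exact centredTPDF_pos hs₁ hs₂ _

/-- Translation invariance of Lebesgue measure reduces integrals over responses to integrals over
residuals, whatever θ is. -/
theorem integral_margLik_mul (hs₁ : 0 < s₁) (hs₂ : 0 < s₂) (D : Fin n → Fin k → ℝ)
    (θ : Fin p → ℝ) (f : (Fin n → ℝ) → ℝ) :
    ∫ y, margLik s₁ s₂ μ D θ y * f (y - fun i => μ θ (D i)) =
      ∫ r, f r * centredTPDF s₁ s₂ r := by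
  rw [← integral_sub_right_eq_self (fun r => f r * centredTPDF s₁ s₂ r) fun i => μ θ (D i)]
  simp only [margLik_eq hs₁ hs₂, mul_comm]

theorem integrable_margLik_mul (hs₁ : 0 < s₁) (hs₂ : 0 < s₂) (D : Fin n → Fin k → ℝ)
    (θ : Fin p → ℝ) {f : (Fin n → ℝ) → ℝ} (hf : Integrable fun r => f r * centredTPDF s₁ s₂ r) :
    Integrable fun y => margLik s₁ s₂ μ D θ y * f (y - fun i => μ θ (D i)) := by
  simp only [margLik_eq hs₁ hs₂, mul_comm (centredTPDF _ _ _)]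
  exact hf.comp_sub_right fun i => μ θ (D i)

theorem integral_responseLaw (hs₁ : 0 < s₁) (hs₂ : 0 < s₂) (D : Fin n → Fin k → ℝ)
    (θ : Fin p → ℝ) (f : (Fin n → ℝ) → ℝ) :
    ∫ y, f (y - fun i => μ θ (D i)) ∂(responseLaw s₁ s₂ μ D θ) =
      ∫ r, f r * centredTPDF s₁ s₂ r := by
  rw [responseLaw, integral_withDensity_eq_integral_toReal_smul
    (measurable_margLik hs₁ hs₂ D θ).ennreal_ofReal (by simp),
    ← integral_margLik_mul (μ := μ) hs₁ hs₂ D θ f]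
  simp only [ENNReal.toReal_ofReal (margLik_pos hs₁ hs₂ D θ _).le, smul_eq_mul]

theorem integrable_responseLaw (hs₁ : 0 < s₁) (hs₂ : 0 < s₂) (D : Fin n → Fin k → ℝ)
    (θ : Fin p → ℝ) {f : (Fin n → ℝ) → ℝ} (hf : Integrable fun r => f r * centredTPDF s₁ s₂ r) :
    Integrable (fun y => f (y - fun i => μ θ (D i))) (responseLaw s₁ s₂ μ D θ) := by
  rw [responseLaw, integrable_withDensity_iff_integrable_smul'
    (measurable_margLik hs₁ hs₂ D θ).ennreal_ofReal (by simp)]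
  simp only [ENNReal.toReal_ofReal (margLik_pos hs₁ hs₂ D θ _).le, smul_eq_mul]
  exact integrable_margLik_mul hs₁ hs₂ D θ hf

/-- The likelihood depends on θ only through the residual sum of squares, so the chain rule along
the line `t ↦ θ + t • v` suffices. -/
theorem hasLineDerivAt_log_margLik (hs₁ : 0 < s₁) (hs₂ : 0 < s₂) (D : Fin n → Fin k → ℝ)
    {θ v : Fin p → ℝ} {a : Fin n → ℝ} (y : Fin n → ℝ)
    (ha : ∀ i, HasLineDerivAt ℝ (fun θ' => μ θ' (D i)) (a i) θ v) :
    HasLineDerivAt ℝ (fun θ' => Real.log (margLik s₁ s₂ μ D θ' y))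
      (directionalScore s₁ s₂ a (y - fun i => μ θ (D i))) θ v := by
  have hΓ₁ := Real.Gamma_pos_of_pos (s := (s₁ + n) / 2) (by positivity)
  have hΓ₂ := Real.Gamma_pos_of_pos (s := s₁ / 2) (by positivity)
  have hlog : ∀ θ', Real.log (margLik s₁ s₂ μ D θ' y) =
      Real.log (Real.Gamma ((s₁ + n) / 2) /
        (Real.Gamma (s₁ / 2) * (s₂ * Real.pi) ^ ((n : ℝ) / 2))) +
      -((s₁ + n) / 2) * Real.log (1 + (∑ i, (y i - μ θ' (D i)) ^ 2) / s₂) := fun θ' => by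
    have hb := one_add_sum_sq_div_pos hs₂ (y - fun i => μ θ' (D i))
    rw [margLik_eq hs₁ hs₂, centredTPDF, Real.log_mul (by positivity)
      (Real.rpow_pos_of_pos hb _).ne', Real.log_rpow hb]
    rfl
  have hb := one_add_sum_sq_div_pos hs₂ (y - fun i => μ θ (D i))
  simp only [hlog]
  unfold HasLineDerivAt at ha ⊢
  have hsum : HasDerivAt (fun t : ℝ => 1 + (∑ i, (y i - μ (θ + t • v) (D i)) ^ 2) / s₂)
      ((∑ i, 2 * (y i - μ θ (D i)) * -a i) / s₂) 0 := by
    refine ((HasDerivAt.fun_sum fun i _ => ?_).div_const s₂).const_add 1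
    have := ((ha i).const_sub (y i)).fun_pow 2
    simpa using this
  have h := ((hsum.log (by simpa using hb.ne')).const_mul (-((s₁ + n) / 2))).const_add
    (Real.log (Real.Gamma ((s₁ + n) / 2) /
        (Real.Gamma (s₁ / 2) * (s₂ * Real.pi) ^ ((n : ℝ) / 2))))
  refine h.congr_deriv ?_
  have hb' : s₂ + ∑ i, (y i - μ θ (D i)) ^ 2 ≠ 0 := by positivity
  have h₁ : 1 + (∑ i, (y i - μ θ (D i)) ^ 2) / s₂ =
      (s₂ + ∑ i, (y i - μ θ (D i)) ^ 2) / s₂ := by field_simp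
  have h₂ : ∑ i, 2 * (y i - μ θ (D i)) * -a i = -2 * ∑ i, (y i - μ θ (D i)) * a i := by
    rw [Finset.mul_sum]; exact Finset.sum_congr rfl fun i _ => by ring
  simp only [directionalScore, Pi.sub_apply, zero_smul, add_zero]
  rw [h₁, h₂]
  field_simp

theorem hasLineDerivAt_pderiv {f : (Fin p → ℝ) → ℝ} {θ : Fin p → ℝ}
    (hf : DifferentiableAt ℝ f θ) (j : Fin p) :
    HasLineDerivAt ℝ f (pderiv f j θ) θ (Pi.single j 1) :=
  hf.lineDifferentiableAt.hasLineDerivAt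

theorem score_eq (hs₁ : 0 < s₁) (hs₂ : 0 < s₂) (D : Fin n → Fin k → ℝ) {θ : Fin p → ℝ}
    (hμ : ∀ i, DifferentiableAt ℝ (fun θ' => μ θ' (D i)) θ) (y : Fin n → ℝ) (j : Fin p) :
    score s₁ s₂ μ D θ y j =
      directionalScore s₁ s₂ (fun i => jacobian μ D θ i j) (y - fun i => μ θ (D i)) :=
  (hasLineDerivAt_log_margLik hs₁ hs₂ D y fun i => hasLineDerivAt_pderiv (hμ i) j).lineDeriv

theorem integrable_score_mul_score (hs₁ : 0 < s₁) (hs₂ : 0 < s₂) (D : Fin n → Fin k → ℝ)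
    {θ : Fin p → ℝ} (hμ : ∀ i, DifferentiableAt ℝ (fun θ' => μ θ' (D i)) θ) (j l : Fin p) :
    Integrable (fun y => score s₁ s₂ μ D θ y j * score s₁ s₂ μ D θ y l)
      (responseLaw s₁ s₂ μ D θ) := by
  simp only [score_eq hs₁ hs₂ D hμ]
  exact integrable_responseLaw hs₁ hs₂ D θ (f := fun r => directionalScore s₁ s₂ _ r *
    directionalScore s₁ s₂ _ r) (integrable_directionalScore_mul hs₁ hs₂ _ _)

theorem fisherInfo_eq (hs₁ : 0 < s₁) (hs₂ : 0 < s₂) (D : Fin n → Fin k → ℝ)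
    {θ : Fin p → ℝ} (hμ : ∀ i, DifferentiableAt ℝ (fun θ' => μ θ' (D i)) θ) :
    fisherInfo s₁ s₂ μ D θ = (s₁ * (s₁ + n) / (s₂ * (s₁ + n + 2))) •
      ((jacobian μ D θ).transpose * jacobian μ D θ) := by
  ext j l
  simp only [fisherInfo, score_eq hs₁ hs₂ D hμ, Matrix.of_apply, Matrix.smul_apply,
    Matrix.mul_apply, Matrix.transpose_apply, smul_eq_mul]
  rw [integral_responseLaw hs₁ hs₂ D θ (fun r => directionalScore s₁ s₂ _ r *
    directionalScore s₁ s₂ _ r), integral_directionalScore_mul hs₁ hs₂]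

theorem trace_fisherInfo_eq (hs₁ : 0 < s₁) (hs₂ : 0 < s₂) (D : Fin n → Fin k → ℝ)
    {θ : Fin p → ℝ} (hμ : ∀ i, DifferentiableAt ℝ (fun θ' => μ θ' (D i)) θ) :
    (fisherInfo s₁ s₂ μ D θ).trace = s₁ * (s₁ + n) / (s₂ * (s₁ + n + 2)) *
      ∑ i, ∑ j, pderiv (fun θ' => μ θ' (D i)) j θ ^ 2 := by
  rw [fisherInfo_eq hs₁ hs₂ D hμ, Matrix.trace_smul, smul_eq_mul, Finset.sum_comm]
  simp only [Matrix.trace, Matrix.diag_apply, Matrix.mul_apply, Matrix.transpose_apply, jacobian,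
    Matrix.of_apply, sq]

/-! ### Expected trace and separable design criteria -/

variable {P : Measure (Fin p → ℝ)}

theorem integral_sum_sum_pderiv_sq {D : Fin n → Fin k → ℝ}
    (hφ : ∀ i j, Integrable (fun θ => pderiv (fun θ' => μ θ' (D i)) j θ ^ 2) P) :
    ∫ θ, ∑ i, ∑ j, pderiv (fun θ' => μ θ' (D i)) j θ ^ 2 ∂P = ∑ i, phi μ P (D i) := by
  rw [integral_finsetSum _ fun i _ => integrable_finsetSum _ fun j _ => hφ i j]
  exact Finset.sum_congr rfl fun i _ => integral_finsetSum _ fun j _ => hφ i j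

theorem integrable_sum_sum_pderiv_sq {D : Fin n → Fin k → ℝ}
    (hφ : ∀ i j, Integrable (fun θ => pderiv (fun θ' => μ θ' (D i)) j θ ^ 2) P) :
    Integrable (fun θ => ∑ i, ∑ j, pderiv (fun θ' => μ θ' (D i)) j θ ^ 2) P :=
  integrable_finsetSum _ fun i _ => integrable_finsetSum _ fun j _ => hφ i j

theorem integrable_trace_fisherInfo (hs₁ : 0 < s₁) (hs₂ : 0 < s₂) {D : Fin n → Fin k → ℝ}
    (hμ : ∀ᵐ θ ∂P, ∀ i, DifferentiableAt ℝ (fun θ' => μ θ' (D i)) θ)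
    (hφ : ∀ i j, Integrable (fun θ => pderiv (fun θ' => μ θ' (D i)) j θ ^ 2) P) :
    Integrable (fun θ => (fisherInfo s₁ s₂ μ D θ).trace) P :=
  ((integrable_sum_sum_pderiv_sq hφ).const_mul _).congr
    (hμ.mono fun _ h => (trace_fisherInfo_eq hs₁ hs₂ D h).symm)

theorem expectedTrace_eq (hs₁ : 0 < s₁) (hs₂ : 0 < s₂) {D : Fin n → Fin k → ℝ}
    (hμ : ∀ᵐ θ ∂P, ∀ i, DifferentiableAt ℝ (fun θ' => μ θ' (D i)) θ)
    (hφ : ∀ i j, Integrable (fun θ => pderiv (fun θ' => μ θ' (D i)) j θ ^ 2) P) :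
    expectedTrace s₁ s₂ μ P D =
      s₁ * (s₁ + n) / (s₂ * (s₁ + n + 2)) * ∑ i, phi μ P (D i) := by
  rw [expectedTrace, integral_congr_ae (hμ.mono fun _ h => trace_fisherInfo_eq hs₁ hs₂ D h),
    integral_const_mul, integral_sum_sum_pderiv_sq hφ]

/-- A separable objective is maximised by maximising each of its terms. -/
theorem isOptimalDesign_iff {𝒟 : Set (Fin k → ℝ)} {U : (Fin n → Fin k → ℝ) → ℝ} {c : ℝ}
    (hc : 0 < c) {f : (Fin k → ℝ) → ℝ}
    (hU : ∀ D : Fin n → Fin k → ℝ, (∀ i, D i ∈ 𝒟) → U D = c * ∑ i, f (D i))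
    (D : Fin n → Fin k → ℝ) :
    IsOptimalDesign 𝒟 U D ↔ ∀ i, D i ∈ 𝒟 ∧ ∀ d ∈ 𝒟, f d ≤ f (D i) := by
  constructor
  · rintro ⟨hD, hmax⟩ i
    refine ⟨hD i, fun d hd => ?_⟩
    -- Exchange argument: comparing `D` with the design whose `i`-th point is replaced by `d`
    -- cancels all the other terms.
    have hD' : ∀ l, Function.update D i d l ∈ 𝒟 := fun l => by
      by_cases h : l = i
      · subst h; simpa using hd
      · simpa [h] using hD l
    have h := hmax _ hD'
    rw [hU _ hD', hU _ hD, mul_le_mul_iff_right₀ hc,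
      ← Finset.add_sum_erase _ (fun l => f (Function.update D i d l)) (Finset.mem_univ i),
      ← Finset.add_sum_erase _ (fun l => f (D l)) (Finset.mem_univ i),
      Finset.sum_congr rfl (g := fun l => f (D l)) fun l hl => by
        rw [Function.update_of_ne (Finset.ne_of_mem_erase hl)]] at h
    simpa only [Function.update_self, add_le_add_iff_right] using h
  · intro h
    refine ⟨fun i => (h i).1, fun D' hD' => ?_⟩
    rw [hU _ hD', hU _ fun i => (h i).1]
    exact mul_le_mul_of_nonneg_left (Finset.sum_le_sum fun i _ => (h i).2 _ (hD' i)) hc.le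

end Model

/-! ### Measurability and the joint law of parameters and responses -/

/-- Regularity is available only on Θ; continuity on an open set of full measure is enough. -/
theorem aemeasurable_of_continuousAt_of_null {α : Type*} [TopologicalSpace α]
    [MeasurableSpace α] [OpensMeasurableSpace α] {P : Measure α} {Θ : Set α} (hΘ : IsOpen Θ)
    (hP : P Θᶜ = 0) {f : α → ℝ} (hf : ∀ θ ∈ Θ, ContinuousAt f θ) : AEMeasurable f P := by
  have h : P.restrict Θ = P := Measure.restrict_eq_self_of_ae_mem hP
  rw [← h]
  have hc : ContinuousOn f Θ := fun θ hθ => (hf θ hθ).continuousWithinAt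
  exact hc.aemeasurable hΘ.measurableSet

section Prior

variable {p n k : ℕ} {s₁ s₂ : ℝ} {μ : (Fin p → ℝ) → (Fin k → ℝ) → ℝ} {P : Measure (Fin p → ℝ)}
  {prior : (Fin p → ℝ) → ℝ} {D : Fin n → Fin k → ℝ}

/-- The derivatives need not be continuous: `fderiv` applied to a fixed vector is measurable for
every function, and it agrees with `pderiv` wherever `f` is differentiable. -/
theorem aemeasurable_pderiv {f : (Fin p → ℝ) → ℝ} (hf : ∀ᵐ θ ∂P, DifferentiableAt ℝ f θ)
    (j : Fin p) : AEMeasurable (pderiv f j) P :=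
  (measurable_fderiv_apply_const ℝ f (Pi.single j (1 : ℝ))).aemeasurable.congr
    (hf.mono fun _ h => h.lineDeriv_eq_fderiv.symm)

theorem aemeasurable_residual [SFinite P] (hm : ∀ i, AEMeasurable (fun θ => μ θ (D i)) P) :
    AEMeasurable (fun z : (Fin p → ℝ) × (Fin n → ℝ) => z.2 - fun i => μ z.1 (D i))
      (P.prod volume) :=
  measurable_snd.aemeasurable.sub (aemeasurable_pi_lambda _ fun i =>
    (hm i).comp_quasiMeasurePreserving Measure.quasiMeasurePreserving_fst)

theorem aemeasurable_margLik [SFinite P] (hs₁ : 0 < s₁) (hs₂ : 0 < s₂)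
    (hm : ∀ i, AEMeasurable (fun θ => μ θ (D i)) P) :
    AEMeasurable (fun z : (Fin p → ℝ) × (Fin n → ℝ) => margLik s₁ s₂ μ D z.1 z.2)
      (P.prod volume) := by
  simp only [margLik_eq hs₁ hs₂]
  exact measurable_centredTPDF.comp_aemeasurable (aemeasurable_residual hm)

/-- The joint law has the marginal likelihood as its density with respect to the product of the
prior and Lebesgue measure, even if the mean is not measurable where the prior vanishes. -/
theorem jointLaw_eq [SFinite P] (hs₁ : 0 < s₁) (hs₂ : 0 < s₂) (hprior : Measurable prior)
    (hP : P = volume.withDensity fun θ => ENNReal.ofReal (prior θ))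
    (hm : ∀ i, AEMeasurable (fun θ => μ θ (D i)) P) :
    jointLaw s₁ s₂ μ prior D =
      (P.prod volume).withDensity fun z => ENNReal.ofReal (margLik s₁ s₂ μ D z.1 z.2) := by
  have hf : Measurable fun z : (Fin p → ℝ) × (Fin n → ℝ) => ENNReal.ofReal (prior z.1) :=
    (hprior.comp measurable_fst).ennreal_ofReal
  obtain ⟨g, hg, hL⟩ := (aemeasurable_margLik (D := D) hs₁ hs₂ hm).ennreal_ofReal
  have hprod : P.prod (volume : Measure (Fin n → ℝ)) =
      volume.withDensity fun z => ENNReal.ofReal (prior z.1) := by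
    rw [hP, prod_withDensity_left hprior.ennreal_ofReal]
    rfl
  -- The measurable version `g` is controlled only where the prior density is nonzero; elsewhere
  -- both joint densities vanish.
  have hae : ∀ᵐ z : (Fin p → ℝ) × (Fin n → ℝ), ENNReal.ofReal (prior z.1) ≠ 0 →
      ENNReal.ofReal (margLik s₁ s₂ μ D z.1 z.2) = g z := by
    have := hL
    rwa [hprod, Filter.EventuallyEq, ae_withDensity_iff hf] at this
  rw [withDensity_congr_ae hL, hprod, ← withDensity_mul _ hf hg, jointLaw]
  refine withDensity_congr_ae (hae.mono fun z hz => ?_)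
  simp only [Pi.mul_apply, ENNReal.ofReal_mul (margLik_pos hs₁ hs₂ D _ _).le]
  rw [mul_comm]
  by_cases h : ENNReal.ofReal (prior z.1) = 0
  · rw [h, zero_mul, zero_mul]
  · rw [hz h]

theorem integrable_withDensity_margLik_iff [SFinite P] (hs₁ : 0 < s₁) (hs₂ : 0 < s₂)
    (hm : ∀ i, AEMeasurable (fun θ => μ θ (D i)) P)
    {F : (Fin p → ℝ) × (Fin n → ℝ) → ℝ} :
    Integrable F ((P.prod volume).withDensity
        fun z => ENNReal.ofReal (margLik s₁ s₂ μ D z.1 z.2)) ↔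
      Integrable (fun z => margLik s₁ s₂ μ D z.1 z.2 * F z) (P.prod volume) := by
  rw [integrable_withDensity_iff_integrable_smul₀'
    (aemeasurable_margLik hs₁ hs₂ hm).ennreal_ofReal (by simp)]
  simp only [ENNReal.toReal_ofReal (margLik_pos hs₁ hs₂ D _ _).le, smul_eq_mul]

theorem integral_withDensity_margLik [SFinite P] (hs₁ : 0 < s₁) (hs₂ : 0 < s₂)
    (hm : ∀ i, AEMeasurable (fun θ => μ θ (D i)) P)
    (F : (Fin p → ℝ) × (Fin n → ℝ) → ℝ) :
    ∫ z, F z ∂(P.prod volume).withDensity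
        (fun z => ENNReal.ofReal (margLik s₁ s₂ μ D z.1 z.2)) =
      ∫ z, margLik s₁ s₂ μ D z.1 z.2 * F z ∂(P.prod volume) := by
  rw [integral_withDensity_eq_integral_toReal_smul₀
    (aemeasurable_margLik hs₁ hs₂ hm).ennreal_ofReal (by simp)]
  simp only [ENNReal.toReal_ofReal (margLik_pos hs₁ hs₂ D _ _).le, smul_eq_mul]

/-- The score in closed form. -/
def scoreFormula (s₁ s₂ : ℝ) (μ : (Fin p → ℝ) → (Fin k → ℝ) → ℝ) (D : Fin n → Fin k → ℝ)
    (j : Fin p) (z : (Fin p → ℝ) × (Fin n → ℝ)) : ℝ :=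
  directionalScore s₁ s₂ (fun i => jacobian μ D z.1 i j) (z.2 - fun i => μ z.1 (D i))

theorem aemeasurable_scoreFormula [SFinite P] (hm : ∀ i, AEMeasurable (fun θ => μ θ (D i)) P)
    (hμ : ∀ᵐ θ ∂P, ∀ i, DifferentiableAt ℝ (fun θ' => μ θ' (D i)) θ) (j : Fin p) :
    AEMeasurable (scoreFormula s₁ s₂ μ D j) (P.prod volume) := by
  have hJ : AEMeasurable (fun θ i => pderiv (fun θ' => μ θ' (D i)) j θ) P :=
    aemeasurable_pi_lambda _ fun i =>
      aemeasurable_pderiv (f := fun θ' => μ θ' (D i)) (ae_all_iff.1 hμ i) j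
  have hJ' : AEMeasurable (fun (z : (Fin p → ℝ) × (Fin n → ℝ)) i =>
      pderiv (fun θ' => μ θ' (D i)) j z.1) (P.prod volume) :=
    hJ.comp_quasiMeasurePreserving Measure.quasiMeasurePreserving_fst
  have hr := aemeasurable_residual (D := D) hm
  have h := (measurable_directionalScore (s₁ := s₁) (s₂ := s₂)).comp_aemeasurable (hJ'.prodMk hr)
  exact h

/-! ### Moments of the score under the joint law -/

section Moments

variable [SFinite P] (hs₁ : 0 < s₁) (hs₂ : 0 < s₂)
  (hm : ∀ i, AEMeasurable (fun θ => μ θ (D i)) P)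
  (hμ : ∀ᵐ θ ∂P, ∀ i, DifferentiableAt ℝ (fun θ' => μ θ' (D i)) θ)
  (hφ : ∀ i j, Integrable (fun θ => pderiv (fun θ' => μ θ' (D i)) j θ ^ 2) P)
include hs₁ hs₂

theorem integral_margLik_mul_scoreFormula_sq (j : Fin p) (θ : Fin p → ℝ) :
    ∫ y, margLik s₁ s₂ μ D θ y * scoreFormula s₁ s₂ μ D j (θ, y) ^ 2 =
      s₁ * (s₁ + n) / (s₂ * (s₁ + n + 2)) *
        ∑ i, pderiv (fun θ' => μ θ' (D i)) j θ ^ 2 := by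
  simp only [scoreFormula, sq]
  rw [integral_margLik_mul hs₁ hs₂ D θ (fun r => directionalScore s₁ s₂ _ r *
    directionalScore s₁ s₂ _ r), integral_directionalScore_mul hs₁ hs₂]
  rfl

include hm

/-- For fixed θ the integrand is odd in the residuals, whatever the coefficients `a θ` are. -/
theorem integral_sum_scoreFormula_mul (a : (Fin p → ℝ) → Fin p → ℝ) :
    ∫ z, ∑ j, scoreFormula s₁ s₂ μ D j z * a z.1 j ∂(P.prod volume).withDensity
        (fun z => ENNReal.ofReal (margLik s₁ s₂ μ D z.1 z.2)) = 0 := by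
  rw [integral_withDensity_margLik hs₁ hs₂ hm]
  -- Fubini needs integrability; without it the integral is zero by convention, so the identity
  -- holds either way.
  by_cases hint : Integrable (fun z : (Fin p → ℝ) × (Fin n → ℝ) => margLik s₁ s₂ μ D z.1 z.2 *
      ∑ j, scoreFormula s₁ s₂ μ D j z * a z.1 j) (P.prod volume)
  · rw [integral_prod _ hint]
    refine integral_eq_zero_of_ae (Filter.Eventually.of_forall fun θ => ?_)
    simp only [scoreFormula]
    rw [integral_margLik_mul hs₁ hs₂ D θ (fun r => ∑ j,
      directionalScore s₁ s₂ (fun i => jacobian μ D θ i j) r * a θ j)]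
    exact integral_eq_zero_of_odd fun r => by
      simp [directionalScore_neg, centredTPDF_neg]
  · exact integral_undef hint

include hμ hφ

/-- The integrand is nonnegative, so it suffices that its integral over `y`, a multiple of a sum of
squared partial derivatives, is integrable under the prior. -/
theorem integrable_margLik_mul_scoreFormula_sq (j : Fin p) :
    Integrable (fun z => margLik s₁ s₂ μ D z.1 z.2 * scoreFormula s₁ s₂ μ D j z ^ 2)
      (P.prod volume) := by
  have hmeas := ((aemeasurable_margLik hs₁ hs₂ hm).mul
    ((aemeasurable_scoreFormula (s₁ := s₁) (s₂ := s₂) hm hμ j).pow_const 2))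
  refine (integrable_prod_iff hmeas.aestronglyMeasurable).2
    ⟨Filter.Eventually.of_forall fun θ => ?_, ?_⟩
  · simp only [Pi.mul_apply, scoreFormula, sq]
    exact integrable_margLik_mul hs₁ hs₂ D θ (f := fun r => directionalScore s₁ s₂ _ r *
      directionalScore s₁ s₂ _ r) (integrable_directionalScore_mul hs₁ hs₂ _ _)
  · have hn : ∀ θ y, ‖margLik s₁ s₂ μ D θ y * scoreFormula s₁ s₂ μ D j (θ, y) ^ 2‖ =
        margLik s₁ s₂ μ D θ y * scoreFormula s₁ s₂ μ D j (θ, y) ^ 2 := fun θ y =>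
      Real.norm_of_nonneg (mul_nonneg (margLik_pos hs₁ hs₂ _ _ _).le (sq_nonneg _))
    simp only [Pi.mul_apply, hn, integral_margLik_mul_scoreFormula_sq hs₁ hs₂]
    exact (integrable_finsetSum _ fun i _ => hφ i j).const_mul _

theorem integrable_scoreFormula_sq (j : Fin p) :
    Integrable (fun z => scoreFormula s₁ s₂ μ D j z ^ 2) ((P.prod volume).withDensity
      fun z => ENNReal.ofReal (margLik s₁ s₂ μ D z.1 z.2)) :=
  (integrable_withDensity_margLik_iff hs₁ hs₂ hm).2
    (integrable_margLik_mul_scoreFormula_sq hs₁ hs₂ hm hμ hφ j)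

theorem integral_sum_scoreFormula_sq :
    ∫ z, ∑ j, scoreFormula s₁ s₂ μ D j z ^ 2 ∂(P.prod volume).withDensity
        (fun z => ENNReal.ofReal (margLik s₁ s₂ μ D z.1 z.2)) =
      s₁ * (s₁ + n) / (s₂ * (s₁ + n + 2)) * ∑ i, phi μ P (D i) := by
  rw [integral_finsetSum _ fun j _ => integrable_scoreFormula_sq hs₁ hs₂ hm hμ hφ j]
  simp only [phi]
  rw [Finset.sum_comm, Finset.mul_sum]
  refine Finset.sum_congr rfl fun j _ => ?_
  rw [integral_withDensity_margLik hs₁ hs₂ hm,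
    integral_prod _ (integrable_margLik_mul_scoreFormula_sq hs₁ hs₂ hm hμ hφ j)]
  simp only [integral_margLik_mul_scoreFormula_sq hs₁ hs₂]
  rw [integral_const_mul, integral_finsetSum _ fun i _ => hφ i j]

end Moments

/-! ### The Fisher information gain utility and its expectation -/

/-- The normaliser is the prior mean of a bounded, everywhere positive likelihood. Positivity for
every `y` lets the log posterior split into a sum. -/
theorem posterior_normaliser_pos [IsProbabilityMeasure P] (hs₁ : 0 < s₁) (hs₂ : 0 < s₂)
    (hprior : Measurable prior) (hprior₀ : ∀ θ, 0 ≤ prior θ)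
    (hP : P = volume.withDensity fun θ => ENNReal.ofReal (prior θ))
    (hm : ∀ i, AEMeasurable (fun θ => μ θ (D i)) P) (y : Fin n → ℝ) :
    0 < ∫ θ, margLik s₁ s₂ μ D θ y * prior θ := by
  have h : ∫ θ, margLik s₁ s₂ μ D θ y * prior θ = ∫ θ, margLik s₁ s₂ μ D θ y ∂P := by
    rw [hP, integral_withDensity_eq_integral_toReal_smul hprior.ennreal_ofReal (by simp)]
    simp only [ENNReal.toReal_ofReal (hprior₀ _), smul_eq_mul, mul_comm]
  have hmeas : AEMeasurable (fun θ => margLik s₁ s₂ μ D θ y) P := by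
    simp only [margLik_eq hs₁ hs₂]
    exact measurable_centredTPDF.comp_aemeasurable
      (aemeasurable_const.sub (aemeasurable_pi_lambda _ hm))
  have hint : Integrable (fun θ => margLik s₁ s₂ μ D θ y) P := by
    refine (integrable_const (centredTPDF s₁ s₂ (0 : Fin n → ℝ))).mono' hmeas.aestronglyMeasurable
      (Filter.Eventually.of_forall fun θ => ?_)
    rw [Real.norm_of_nonneg (margLik_pos hs₁ hs₂ _ _ _).le, margLik_eq hs₁ hs₂]
    exact centredTPDF_le hs₁ hs₂ _
  rw [h, integral_pos_iff_support_of_nonneg (fun θ => (margLik_pos hs₁ hs₂ D θ y).le) hint,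
    Function.support_eq_univ fun θ => (margLik_pos hs₁ hs₂ D θ y).ne']
  simp

theorem utilityFIG_eq (hs₁ : 0 < s₁) (hs₂ : 0 < s₂) {θ : Fin p → ℝ}
    (hμ : ∀ i, DifferentiableAt ℝ (fun θ' => μ θ' (D i)) θ) (hd : DifferentiableAt ℝ prior θ)
    (hpos : 0 < prior θ) {y : Fin n → ℝ} (hZ : 0 < ∫ θ, margLik s₁ s₂ μ D θ y * prior θ) :
    utilityFIG s₁ s₂ μ prior θ y D =
      ∑ j, scoreFormula s₁ s₂ μ D j (θ, y) ^ 2 + 2 * ∑ j, scoreFormula s₁ s₂ μ D j (θ, y) *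
        pderiv (fun θ' => Real.log (prior θ')) j θ := by
  have key : ∀ j, pderiv (fun θ' => Real.log (posterior s₁ s₂ μ prior D y θ')) j θ =
      scoreFormula s₁ s₂ μ D j (θ, y) + pderiv (fun θ' => Real.log (prior θ')) j θ := fun j => by
    have h₁ := hasLineDerivAt_log_margLik hs₁ hs₂ D y fun i => hasLineDerivAt_pderiv (hμ i) j
    have h₂ := hasLineDerivAt_pderiv (hd.log hpos.ne') j
    have h₃ := (HasDerivAt.add h₁ h₂).sub_const
      (Real.log (∫ θ, margLik s₁ s₂ μ D θ y * prior θ))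
    refine HasLineDerivAt.lineDeriv (HasDerivAt.congr_of_eventuallyEq h₃ ?_)
    -- The prior may vanish away from θ. Continuity keeps it positive for small `t`, which is all
    -- that a derivative at `t = 0` requires.
    have hc : ContinuousAt (fun t : ℝ => prior (θ + t • Pi.single j 1)) 0 :=
      ContinuousAt.comp' (f := fun t : ℝ => θ + t • Pi.single j (1 : ℝ))
        (by simpa using hd.continuousAt) (by fun_prop)
    filter_upwards [hc.eventually (lt_mem_nhds (by simpa using hpos))] with t ht
    rw [posterior, Real.log_div (mul_pos (margLik_pos hs₁ hs₂ _ _ _) ht).ne' hZ.ne',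
      Real.log_mul (margLik_pos hs₁ hs₂ _ _ _).ne' ht.ne']
    rfl
  simp only [utilityFIG, key]
  rw [Finset.mul_sum, ← Finset.sum_add_distrib, ← Finset.sum_sub_distrib]
  exact Finset.sum_congr rfl fun j _ => by ring

theorem ae_prior_pos (hprior : Measurable prior)
    (hP : P = volume.withDensity fun θ => ENNReal.ofReal (prior θ)) :
    ∀ᵐ θ ∂P, 0 < prior θ := by
  rw [hP, ae_withDensity_iff hprior.ennreal_ofReal]
  exact Filter.Eventually.of_forall fun θ h => by simpa using h

section Utility

variable [IsProbabilityMeasure P] (hs₁ : 0 < s₁) (hs₂ : 0 < s₂) (hprior : Measurable prior)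
  (hprior₀ : ∀ θ, 0 ≤ prior θ)
  (hP : P = volume.withDensity fun θ => ENNReal.ofReal (prior θ))
  (hd : ∀ᵐ θ ∂P, DifferentiableAt ℝ prior θ)
  (hm : ∀ i, AEMeasurable (fun θ => μ θ (D i)) P)
  (hμ : ∀ᵐ θ ∂P, ∀ i, DifferentiableAt ℝ (fun θ' => μ θ' (D i)) θ)
  (hφ : ∀ i j, Integrable (fun θ => pderiv (fun θ' => μ θ' (D i)) j θ ^ 2) P)
include hs₁ hs₂ hprior hprior₀ hP hd hm hμ

/-- The exceptional set involves θ alone, so it stays null under the product with Lebesgue measure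
and under the joint law. -/
theorem utilityFIG_ae_eq :
    (fun z => utilityFIG s₁ s₂ μ prior z.1 z.2 D) =ᵐ[(P.prod volume).withDensity
        fun z => ENNReal.ofReal (margLik s₁ s₂ μ D z.1 z.2)]
      fun z => ∑ j, scoreFormula s₁ s₂ μ D j z ^ 2 + 2 * ∑ j, scoreFormula s₁ s₂ μ D j z *
        pderiv (fun θ' => Real.log (prior θ')) j z.1 := by
  have h : ∀ᵐ θ ∂P, ∀ y : Fin n → ℝ, utilityFIG s₁ s₂ μ prior θ y D =
      ∑ j, scoreFormula s₁ s₂ μ D j (θ, y) ^ 2 + 2 * ∑ j, scoreFormula s₁ s₂ μ D j (θ, y) *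
        pderiv (fun θ' => Real.log (prior θ')) j θ := by
    filter_upwards [hd, hμ, ae_prior_pos hprior hP] with θ h₁ h₂ h₃ y
    exact utilityFIG_eq hs₁ hs₂ h₂ h₁ h₃
      (posterior_normaliser_pos hs₁ hs₂ hprior hprior₀ hP hm y)
  refine (withDensity_absolutelyContinuous _ _).ae_le ?_
  exact (Measure.quasiMeasurePreserving_fst.ae h).mono fun z hz => hz z.2

include hφ

theorem expectedFIG_eq
    (hint : Integrable (fun z => utilityFIG s₁ s₂ μ prior z.1 z.2 D)
      (jointLaw s₁ s₂ μ prior D)) :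
    expectedFIG s₁ s₂ μ prior D =
      s₁ * (s₁ + n) / (s₂ * (s₁ + n + 2)) * ∑ i, phi μ P (D i) := by
  have hae := utilityFIG_ae_eq hs₁ hs₂ hprior hprior₀ hP hd hm hμ
  rw [expectedFIG]
  rw [jointLaw_eq hs₁ hs₂ hprior hP hm] at hint ⊢
  have hS : Integrable (fun z => ∑ j, scoreFormula s₁ s₂ μ D j z ^ 2)
      ((P.prod volume).withDensity fun z => ENNReal.ofReal (margLik s₁ s₂ μ D z.1 z.2)) :=
    integrable_finsetSum _ fun j _ => integrable_scoreFormula_sq hs₁ hs₂ hm hμ hφ j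
  -- The cross term is integrable as the utility minus `|S|²`; finite Fisher information of the
  -- prior is not required here.
  have hT := (hint.congr hae).sub hS
  simp only [Pi.sub_def, add_sub_cancel_left] at hT
  rw [integral_congr_ae hae, integral_add hS hT, integral_const_mul,
    integral_sum_scoreFormula_mul hs₁ hs₂ hm fun θ j => pderiv (fun θ' => Real.log (prior θ')) j θ,
    mul_zero, add_zero, integral_sum_scoreFormula_sq hs₁ hs₂ hm hμ hφ]

theorem integrable_utilityFIG
    (hfin : ∀ j, Integrable (fun θ => pderiv (fun θ' => Real.log (prior θ')) j θ ^ 2) P) :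
    Integrable (fun z => utilityFIG s₁ s₂ μ prior z.1 z.2 D) (jointLaw s₁ s₂ μ prior D) := by
  rw [jointLaw_eq hs₁ hs₂ hprior hP hm]
  refine Integrable.congr ?_ (utilityFIG_ae_eq hs₁ hs₂ hprior hprior₀ hP hd hm hμ).symm
  have hS := integrable_scoreFormula_sq hs₁ hs₂ hm hμ hφ
  refine (integrable_finsetSum _ fun j _ => hS j).add
    ((integrable_finsetSum _ fun j _ => ?_).const_mul 2)
  -- The likelihood integrates to one over `y`, so functions of θ integrable under the prior stay
  -- integrable under the joint law. With `|u v| ≤ u² + v²` this dominates the cross term.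
  have ha : Integrable (fun z : (Fin p → ℝ) × (Fin n → ℝ) =>
      pderiv (fun θ' => Real.log (prior θ')) j z.1 ^ 2) ((P.prod volume).withDensity
        fun z => ENNReal.ofReal (margLik s₁ s₂ μ D z.1 z.2)) := by
    have hθ : AEMeasurable (fun z : (Fin p → ℝ) × (Fin n → ℝ) =>
        pderiv (fun θ' => Real.log (prior θ')) j z.1 ^ 2) (P.prod volume) := (hfin j).aestronglyMeasurable.aemeasurable.comp_quasiMeasurePreserving
      Measure.quasiMeasurePreserving_fst
    refine (integrable_withDensity_margLik_iff hs₁ hs₂ hm).2 ((integrable_prod_iff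
      ((aemeasurable_margLik hs₁ hs₂ hm).mul hθ).aestronglyMeasurable).2 ?_)
    have h₁ : ∀ θ, Integrable fun y => margLik s₁ s₂ μ D θ y := fun θ => by
      simpa using integrable_margLik_mul hs₁ hs₂ D θ (μ := μ) (f := fun _ => 1)
        (by simpa using integrable_centredTPDF hs₁ hs₂)
    have h₂ : ∀ θ, ∫ y, margLik s₁ s₂ μ D θ y = 1 := fun θ => by
      have h := integral_margLik_mul hs₁ hs₂ D θ (μ := μ) fun _ => 1
      simp only [mul_one, one_mul] at h
      rw [h, integral_eq_lintegral_of_nonneg_ae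
        (Filter.Eventually.of_forall fun r => (centredTPDF_pos hs₁ hs₂ r).le)
        measurable_centredTPDF.aestronglyMeasurable, lintegral_centredTPDF hs₁ hs₂,
        ENNReal.toReal_one]
    simp only [Pi.mul_apply]
    refine ⟨Filter.Eventually.of_forall fun θ => (h₁ θ).mul_const _, ?_⟩
    simp only [norm_mul, integral_mul_const, Real.norm_of_nonneg (margLik_pos hs₁ hs₂ D _ _).le,
      h₂, one_mul]
    exact (hfin j).norm
  have hlog : AEMeasurable (pderiv (fun θ' => Real.log (prior θ')) j) P :=
    aemeasurable_pderiv (by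
      filter_upwards [hd, ae_prior_pos hprior hP] with θ h₁ h₂ using h₁.log h₂.ne') j
  refine ((hS j).add ha).mono' (AEMeasurable.aestronglyMeasurable
    (AEMeasurable.mono_ac ((aemeasurable_scoreFormula hm hμ j).mul
      (hlog.comp_quasiMeasurePreserving Measure.quasiMeasurePreserving_fst))
      (withDensity_absolutelyContinuous _ _))) (Filter.Eventually.of_forall fun z => ?_)
  rw [Real.norm_eq_abs, Pi.add_apply]
  set u := scoreFormula s₁ s₂ μ D j z
  set v := pderiv (fun θ' => Real.log (prior θ')) j z.1
  exact abs_le.2 ⟨by nlinarith [sq_nonneg (u + v), sq_nonneg u, sq_nonneg v],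
    by nlinarith [sq_nonneg (u - v), sq_nonneg u, sq_nonneg v]⟩

end Utility

end Prior

end FIG

end

/-! ### Assembly of the claims -/

theorem lemma2 (p n k : ℕ) (s₁ s₂ : ℝ) (hs₁ : 0 < s₁) (hs₂ : 0 < s₂)
    (𝒟 : Set (Fin k → ℝ)) (μ : (Fin p → ℝ) → (Fin k → ℝ) → ℝ)
    -- the parameter space, on which the mean function is differentiable
    (Θ : Set (Fin p → ℝ)) (hΘ : IsOpen Θ)
    (hμ : ∀ d ∈ 𝒟, ∀ θ ∈ Θ, DifferentiableAt ℝ (fun θ' => μ θ' d) θ)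
    -- the prior distribution of the parameters
    (P : Measure (Fin p → ℝ)) [IsProbabilityMeasure P] (hP : P Θᶜ = 0)
    -- the expectations that define `φ` exist
    (hφ : ∀ d ∈ 𝒟, ∀ j, Integrable (fun θ => FIG.pderiv (fun θ' => μ θ' d) j θ ^ 2) P) :
    -- the marginal likelihood is a multivariate t density
    (∀ (D : Fin n → Fin k → ℝ) (θ : Fin p → ℝ),
      IsProbabilityMeasure (FIG.responseLaw s₁ s₂ μ D θ) ∧
      ∀ y : Fin n → ℝ,
        IntegrableOn (fun γ => FIG.condLik μ D θ γ y * FIG.invGammaPDF (s₁ / 2) (s₂ / 2) γ)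
          (Set.Ioi 0) ∧
        FIG.margLik s₁ s₂ μ D θ y =
          FIG.multivariateTPDF s₁ (fun i => μ θ (D i))
            ((s₂ / s₁) • (1 : Matrix (Fin n) (Fin n) ℝ)) y) ∧
    -- its Fisher information
    (∀ D : Fin n → Fin k → ℝ, (∀ i, D i ∈ 𝒟) → ∀ θ ∈ Θ,
      (∀ j l, Integrable (fun y => FIG.score s₁ s₂ μ D θ y j * FIG.score s₁ s₂ μ D θ y l)
        (FIG.responseLaw s₁ s₂ μ D θ)) ∧
      FIG.fisherInfo s₁ s₂ μ D θ =
        (s₁ * (s₁ + n) / (s₂ * (s₁ + n + 2))) •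
          ((FIG.jacobian μ D θ).transpose * FIG.jacobian μ D θ)) ∧
    -- the prior expectation of the trace of the Fisher information
    (∀ D : Fin n → Fin k → ℝ, (∀ i, D i ∈ 𝒟) →
      Integrable (fun θ => (FIG.fisherInfo s₁ s₂ μ D θ).trace) P ∧
      FIG.expectedTrace s₁ s₂ μ P D =
        s₁ * (s₁ + n) / (s₂ * (s₁ + n + 2)) * ∑ i, FIG.phi μ P (D i)) ∧
    -- it is maximal exactly when every design point maximises `φ`
    (∀ D : Fin n → Fin k → ℝ,
      FIG.IsOptimalDesign 𝒟 (FIG.expectedTrace s₁ s₂ μ P) D ↔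
        ∀ i, D i ∈ 𝒟 ∧ ∀ d ∈ 𝒟, FIG.phi μ P d ≤ FIG.phi μ P (D i)) ∧
    -- the expected utility, for a prior that has a density which is differentiable on `Θ`
    (∀ prior : (Fin p → ℝ) → ℝ, Measurable prior → (∀ θ, 0 ≤ prior θ) →
      P = volume.withDensity (fun θ => ENNReal.ofReal (prior θ)) →
      (∀ θ ∈ Θ, DifferentiableAt ℝ prior θ) →
      -- the expected utility exists if the prior density has finite Fisher information
      ((∀ j, Integrable (fun θ => FIG.pderiv (fun θ' => Real.log (prior θ')) j θ ^ 2) P) →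
        ∀ D : Fin n → Fin k → ℝ, (∀ i, D i ∈ 𝒟) →
          Integrable (fun z => FIG.utilityFIG s₁ s₂ μ prior z.1 z.2 D)
            (FIG.jointLaw s₁ s₂ μ prior D)) ∧
      -- its value whenever it exists
      (∀ D : Fin n → Fin k → ℝ, (∀ i, D i ∈ 𝒟) →
        Integrable (fun z => FIG.utilityFIG s₁ s₂ μ prior z.1 z.2 D)
          (FIG.jointLaw s₁ s₂ μ prior D) →
        FIG.expectedFIG s₁ s₂ μ prior D =
          s₁ * (s₁ + n) / (s₂ * (s₁ + n + 2)) * ∑ i, FIG.phi μ P (D i)) ∧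
      -- it is maximal exactly when every design point maximises `φ`
      ((∀ D : Fin n → Fin k → ℝ, (∀ i, D i ∈ 𝒟) →
          Integrable (fun z => FIG.utilityFIG s₁ s₂ μ prior z.1 z.2 D)
            (FIG.jointLaw s₁ s₂ μ prior D)) →
        ∀ D : Fin n → Fin k → ℝ,
          FIG.IsOptimalDesign 𝒟 (FIG.expectedFIG s₁ s₂ μ prior) D ↔
            ∀ i, D i ∈ 𝒟 ∧ ∀ d ∈ 𝒟, FIG.phi μ P d ≤ FIG.phi μ P (D i))) := by
  have hc : 0 < s₁ * (s₁ + n) / (s₂ * (s₁ + n + 2)) := by positivity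
  have hΘ_ae : ∀ᵐ θ ∂P, θ ∈ Θ := hP
  have hμ_ae : ∀ D : Fin n → Fin k → ℝ, (∀ i, D i ∈ 𝒟) →
      ∀ᵐ θ ∂P, ∀ i, DifferentiableAt ℝ (fun θ' => μ θ' (D i)) θ := fun D hD =>
    hΘ_ae.mono fun θ hθ i => hμ _ (hD i) θ hθ
  have hm : ∀ D : Fin n → Fin k → ℝ, (∀ i, D i ∈ 𝒟) →
      ∀ i, AEMeasurable (fun θ => μ θ (D i)) P := fun D hD i =>
    FIG.aemeasurable_of_continuousAt_of_null hΘ hP fun θ hθ => (hμ _ (hD i) θ hθ).continuousAt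
  have htrace := fun (D : Fin n → Fin k → ℝ) (hD : ∀ i, D i ∈ 𝒟) =>
    FIG.expectedTrace_eq hs₁ hs₂ (hμ_ae D hD) fun i => hφ _ (hD i)
  refine ⟨fun D θ => ⟨FIG.isProbabilityMeasure_responseLaw hs₁ hs₂ D θ, fun y =>
      ⟨FIG.integrableOn_prod_gaussianPDFReal_mul_invGammaPDF hs₁ hs₂ _ y, ?_⟩⟩,
    fun D hD θ hθ => ⟨FIG.integrable_score_mul_score hs₁ hs₂ D fun i => hμ _ (hD i) θ hθ,
      FIG.fisherInfo_eq hs₁ hs₂ D fun i => hμ _ (hD i) θ hθ⟩,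
    fun D hD => ⟨FIG.integrable_trace_fisherInfo hs₁ hs₂ (hμ_ae D hD) fun i => hφ _ (hD i),
      htrace D hD⟩,
    FIG.isOptimalDesign_iff hc htrace, fun prior hprior hprior₀ hPd hdiff => ?_⟩
  · rw [FIG.margLik_eq hs₁ hs₂, FIG.multivariateTPDF_smul_one hs₁ hs₂]
  · have hd : ∀ᵐ θ ∂P, DifferentiableAt ℝ prior θ := hΘ_ae.mono fun θ hθ => hdiff θ hθ
    have hval := fun (D : Fin n → Fin k → ℝ) (hD : ∀ i, D i ∈ 𝒟) =>
      FIG.expectedFIG_eq hs₁ hs₂ hprior hprior₀ hPd hd (hm D hD) (hμ_ae D hD)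
        fun i => hφ _ (hD i)
    exact ⟨fun hfin D hD => FIG.integrable_utilityFIG hs₁ hs₂ hprior hprior₀ hPd hd (hm D hD)
        (hμ_ae D hD) (fun i => hφ _ (hD i)) hfin,
      hval, fun hint => FIG.isOptimalDesign_iff hc fun D hD => hval D hD (hint D hD)⟩
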